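/- Let $\mathfrak g$ be a finite-dimensional complex semisimple Lie algebra with Killing form $B$, $\mathfrak h$ a Cartan subalgebra, $\Delta$ the set of roots, $\Delta_+$ a choice of positive roots, and $\Pi\subset\Delta_+$ the set of simple roots; for $\varphi\in\Delta$ write $\varphi=\sum_{\alpha\in\Pi}n_\alpha(\varphi)\,\alpha$ with $n_\alpha(\varphi)\in\mathbb Z$. Let $\mathfrak q\neq\mathfrak g$ be a subalgebra of $\mathfrak g$ containing the Borel subalgebra spanned by $\mathfrak h$ and the positive root vectors, let $\mathfrak n$ be the nilradical (largest nilpotent ideal) of $\mathfrak q$, and let $\mathfrak m$ be the Levi factor of $\mathfrak q$ containing $\mathfrak h$, so that $\mathfrak q=\mathfrak m\oplus\mathfrak n$. Put $\mathfrak t=\operatorname{cent}\mathfrak m$, $\mathfrak s=[\mathfrak m,\mathfrak m]$, $\mathfrak h(\mathfrak s)=\mathfrak h\cap\mathfrak s$, $\ell(\mathfrak t)=\dim\mathfrak t$, $\ell(\mathfrak s)=\dim\mathfrak h(\mathfrak s)$. Let $(\cdot,\cdot)$ be the bilinear form on $\mathfrak h^*$ induced by $B|\mathfrak h$. Regard $\mathfrak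 t^*\subset\mathfrak h^*$ as the space of functionals vanishing on $\mathfrak h(\mathfrak s)$. Let $\mathfrak h^*_{\mathbb R}$ and $\mathfrak h(\mathfrak s)^*_{\mathbb R}$ be the real spans of $\Delta$ and of $\Delta(\mathfrak s)$, the set of roots whose root vectors lie in $\mathfrak s$; let $\mathfrak t^*_{\mathbb R}$ be the orthogonal complement of $\mathfrak h(\mathfrak s)^*_{\mathbb R}$ in $\mathfrak h^*_{\mathbb R}$, and for $\gamma\in\mathfrak h^*_{\mathbb R}$ let $\gamma_{\mathfrak t}\in\mathfrak t^*_{\mathbb R}$ be the component of $\gamma$ in $\mathfrak h^*_{\mathbb R}=\mathfrak t^*_{\mathbb R}\oplus\mathfrak h(\mathfrak s)^*_{\mathbb R}$. For $\nu\in\mathfrak t^*$ let $\mathfrak g_\nu=\{z\in\mathfrak g:[x,z]=\nu(x)z\ \ \forall x\in\mathfrak t\}$, and let $\Delta(\mathfrak g_\nu)$ be the set of $\varphi\in\Delta$ whose root vectors lie in $\mathfrak g_\nu$ (for $\nu\neq0$, equivalently, $\varphi_{\mathfrak t}=\nu$). A $\mathfrak t$-root is a nonzero $\nu\in\mathfrak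 t^*$ with $\mathfrak g_\nu\neq0$; let $R$ be the set of $\mathfrak t$-roots. Let $\delta_{\mathfrak n}(x)=\operatorname{tr}(\operatorname{ad}x|_{\mathfrak n})$ for $x\in\mathfrak h$. For an orthogonal ordered basis of $\mathfrak t^*_{\mathbb R}$ with first element $\delta_{\mathfrak n}$, let $R_+$ be the set of $\mathfrak t$-roots that are positive in the corresponding lexicographic ordering, and let $R_{\rm simp}$ be the set of $\nu\in R_+$ that are not of the form $\nu_1+\nu_2$ with $\nu_1,\nu_2\in R_+$. **Theorem 2.7.** The simple roots can be enumerated as $\Pi=\{\alpha_1,\dots,\alpha_{\ell(\mathfrak t)+\ell(\mathfrak s)}\}$, without repetition, so that $\alpha_{\ell(\mathfrak t)+i}\in\Delta(\mathfrak s)$ for $i=1,\dots,\ell(\mathfrak s)$, and $\mathfrak t^*_{\mathbb R}$ has an orthogonal ordered basis with first element $\delta_{\mathfrak n}$. For every such enumeration and every such ordered basis, put $\beta_j=(\alpha_j)_{\mathfrak t}$ for $j=1,\dots,\ell(\mathfrak t)$. Then $$R_{\rm simp}=\{\beta_1,\dots,\beta_{\ell(\mathfrak t)}\},$$ the elements $\beta_1,\dots,\beta_{\ell(\mathfrak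 t)}$ form a basis of $\mathfrak t^*_{\mathbb R}$, and $(\beta_i,\beta_j)$ is real and $\le0$ for $i\neq j$. Furthermore, for every $\nu\in R_+$ the set $\Delta(\mathfrak g_\nu)$ is nonempty, and for every $\varphi\in\Delta(\mathfrak g_\nu)$ $$\nu=\sum_{j=1}^{\ell(\mathfrak t)}n_{\alpha_j}(\varphi)\,\beta_j .$$ -/

import Mathlib

open LieAlgebra LieAlgebra.IsKilling Module

namespace LeviRoots

noncomputable section

variable {L : Type*} [LieRing L] [LieAlgebra ℂ L] [FiniteDimensional ℂ L]
  [LieAlgebra.IsSemisimple ℂ L] {H : LieSubalgebra ℂ L} [H.IsCartanSubalgebra]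

/-- The bilinear form `(μ, ν)` on the dual of the Cartan subalgebra `H` induced by the restriction
to `H` of the Killing form `B`: `(μ, ν) = B (τ⁻¹ μ) (τ⁻¹ ν)`, where `τ : H ≃ Dual H` is the
isomorphism defined by `B`. -/
def pair (μ ν : Dual ℂ H) : ℂ :=
  killingForm ℂ L ((cartanEquivDual H).symm μ : H) ((cartanEquivDual H).symm ν : H)

/-- `Δ(u)`: the roots whose root vectors lie in the subspace `u`. -/
def rootsIn (H : LieSubalgebra ℂ L) [H.IsCartanSubalgebra] (u : Submodule ℂ L) : Set H.root :=
  {φ | (rootSpace H φ.1).toSubmodule ≤ u}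

/-- `n_α(φ)`: the integer coefficient of the simple root `α` in the root `φ`. -/
def simpleCoeff (b : (rootSystem H).Base) (α φ : H.root) : ℤ :=
  (b.exists_root_eq_sum_int φ).choose α

/-! ### The standard parabolic subalgebra and its Levi decomposition -/

/-- The Borel subalgebra (as a subspace) spanned by `H` and the positive root spaces. -/
def borel (b : (rootSystem H).Base) : Submodule ℂ L :=
  H.toSubmodule ⊔ ⨆ φ ∈ {φ : H.root | b.IsPos φ}, (rootSpace H φ.1).toSubmodule

/-- A standard parabolic subalgebra is a subalgebra containing the Borel subalgebra. -/
def IsStandardParabolic (b : (rootSystem H).Base) (q : LieSubalgebra ℂ L) : Prop :=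
  borel b ≤ q.toSubmodule

lemma IsStandardParabolic.cartan_le {b : (rootSystem H).Base} {q : LieSubalgebra ℂ L}
    (hq : IsStandardParabolic b q) : H ≤ q := fun _ hx =>
  hq (Submodule.mem_sup_left hx)

/-- The nilradical of `q`: its largest nilpotent ideal, the sum of all the ideals of `q` that are
nilpotent as Lie algebras. -/
def nilradical (q : LieSubalgebra ℂ L) : LieIdeal ℂ q :=
  sSup {I : LieIdeal ℂ q | LieRing.IsNilpotent I}

/-- The nilradical `n` of `q` as a subspace of the ambient Lie algebra. -/
def nilradicalSubmodule (q : LieSubalgebra ℂ L) : Submodule ℂ L :=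
  (nilradical q).toSubmodule.map q.toSubmodule.subtype

/-- `m` is a Levi factor of the parabolic subalgebra `q`: a subalgebra of `q` that is
a vector space complement of the nilradical, `q = m ⊕ n`. -/
structure IsLeviFactor (q m : LieSubalgebra ℂ L) : Prop where
  inf_eq_bot : m.toSubmodule ⊓ nilradicalSubmodule q = ⊥
  sup_eq : m.toSubmodule ⊔ nilradicalSubmodule q = q.toSubmodule

/-- The center `t` of `m`, as a subspace of the ambient Lie algebra. -/
def leviCenter (m : LieSubalgebra ℂ L) : Submodule ℂ L :=
  (LieAlgebra.center ℂ m).toSubmodule.map m.toSubmodule.subtype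

/-- The derived algebra `s = [m, m]`, as a subspace of the ambient Lie algebra. -/
def leviDerived (m : LieSubalgebra ℂ L) : Submodule ℂ L :=
  (LieAlgebra.derivedSeries ℂ m 1).toSubmodule.map m.toSubmodule.subtype

/-- `h(s) = h ∩ s`, as a subspace of the Cartan subalgebra. -/
def cartanDerived (H m : LieSubalgebra ℂ L) : Submodule ℂ H :=
  (leviDerived m).comap H.toSubmodule.subtype

/-- The functional `δ_n` on `H`: `δ_n x` is the trace of `ad x` on the nilradical `n` of `q`. -/
def deltaN (q : LieSubalgebra ℂ L) (hHq : H ≤ q) : Dual ℂ H :=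
  LinearMap.trace ℂ (nilradical q) ∘ₗ
    (LieModule.toEnd ℂ q (nilradical q) : q →ₗ[ℂ] Module.End ℂ (nilradical q)) ∘ₗ
    (LieSubalgebra.inclusion hHq : H →ₗ[ℂ] q)

/-! ### The real spaces and the component along `t` -/

/-- The real span of a set of roots. -/
def realSpan (S : Set H.root) : Submodule ℝ (Dual ℂ H) :=
  Submodule.span ℝ ((rootSystem H).root '' S)

variable (H) in
/-- `h*_ℝ`: the real span of all roots. -/
def hR : Submodule ℝ (Dual ℂ H) := realSpan (H := H) Set.univ

variable (H) in
/-- `h(s)*_ℝ`: the real span of the roots of `s`. -/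
def hsR (m : LieSubalgebra ℂ L) : Submodule ℝ (Dual ℂ H) :=
  realSpan (rootsIn H (leviDerived m))

lemma pair_eq_sum (μ ν : Dual ℂ H) : pair μ ν =
    ∑ χ : H.root, χ.1 ((cartanEquivDual H).symm μ) * χ.1 ((cartanEquivDual H).symm ν) := by
  have h := LinearMap.congr_fun₂ (corootForm_rootSystem_eq_killing (K := ℂ) (L := L) (H := H))
    ((cartanEquivDual H).symm μ) ((cartanEquivDual H).symm ν)
  rw [RootPairing.corootForm_apply_apply] at h
  exact h.symm

lemma pair_add_right (μ ν ν' : Dual ℂ H) : pair μ (ν + ν') = pair μ ν + pair μ ν' := by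
  rw [pair, pair, pair, map_add, Submodule.coe_add, map_add]

lemma pair_smul_right (μ ν : Dual ℂ H) (c : ℝ) : pair μ (c • ν) = c * pair μ ν := by
  have h : c • ν = (c : ℂ) • ν := by ext; simp
  rw [h, pair, pair, map_smul, Submodule.coe_smul, map_smul, smul_eq_mul]

lemma pair_comm (μ ν : Dual ℂ H) : pair μ ν = pair ν μ := by
  simp [pair_eq_sum, mul_comm]

lemma root_apply_im {μ : Dual ℂ H} (hμ : μ ∈ hR H) (χ : H.root) :
    (χ.1 ((cartanEquivDual H).symm μ)).im = 0 := by
  induction hμ using Submodule.span_induction with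
  | zero => simp
  | add x y _ _ hx hy =>
    have : χ.1 ((cartanEquivDual H).symm (x + y)) = χ.1 ((cartanEquivDual H).symm x) +
        χ.1 ((cartanEquivDual H).symm y) := by
      rw [map_add]; exact χ.1.toLinear.map_add _ _
    rw [this, Complex.add_im, hx, hy, add_zero]
  | smul c x _ hx =>
    have h1 : c • x = (c : ℂ) • x := by ext; simp
    have : χ.1 ((cartanEquivDual H).symm (c • x)) = c * χ.1 ((cartanEquivDual H).symm x) := by
      rw [h1, map_smul]; exact χ.1.toLinear.map_smul _ _
    simp [this, hx]
  | mem x hx =>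
    obtain ⟨ψ, -, rfl⟩ := hx
    have hψ : ψ.1.IsNonZero := (Finset.mem_filter.mp ψ.2).2
    have hN := root_apply_cartanEquivDual_symm_ne_zero hψ
    set t := (cartanEquivDual H).symm (ψ.1 : Dual ℂ H) with ht
    have hco : t = (ψ.1 t / 2) • coroot ψ.1 := by
      rw [coroot, ← ht]
      rw [← Nat.cast_smul_eq_nsmul ℂ, smul_smul, smul_smul]
      have : ψ.1 t / 2 * ((2 : ℕ) : ℂ) * (ψ.1 t)⁻¹ = 1 := by
        push_cast; field_simp
      rw [this, one_smul]
    have hint : ∀ χ : H.root, ∃ n : ℤ, χ.1 (coroot ψ.1) = n := fun χ =>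
      ⟨_, apply_coroot_eq_cast' ψ.1 χ.1⟩
    choose n hn using hint
    have happ : ∀ χ : H.root, χ.1 t = (ψ.1 t / 2) * n χ := by
      intro χ
      rw [← hn χ]
      conv_lhs => rw [hco]
      exact χ.1.toLinear.map_smul _ _
    have h2 : ψ.1 t = pair (ψ.1 : Dual ℂ H) (ψ.1 : Dual ℂ H) := by
      have := LinearMap.congr_fun ((cartanEquivDual H).apply_symm_apply (ψ.1 : Dual ℂ H)) t
      rw [cartanEquivDual_apply_apply] at this
      exact this.symm
    rw [pair_eq_sum, ← ht] at h2
    have h2' : ψ.1 t = ∑ χ, (ψ.1 t / 2 * n χ) * (ψ.1 t / 2 * n χ) :=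
      h2.trans (Finset.sum_congr rfl fun χ _ => by rw [← happ χ])
    have h3 : ψ.1 t * (∑ χ, (n χ : ℂ) ^ 2) = 4 := by
      have : (ψ.1 t) * (ψ.1 t * (∑ χ, (n χ : ℂ) ^ 2)) = ψ.1 t * 4 := by
        conv_rhs => rw [h2']
        rw [Finset.mul_sum, Finset.mul_sum, Finset.sum_mul]
        refine Finset.sum_congr rfl fun _ _ => ?_
        ring
      exact mul_left_cancel₀ hN this
    have h4 : ψ.1 t = ((4 / (∑ χ, (n χ : ℝ) ^ 2) : ℝ) : ℂ) := by
      have : (∑ χ, (n χ : ℂ) ^ 2) ≠ 0 := by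
        intro h
        rw [h, mul_zero] at h3
        norm_num at h3
      push_cast
      rw [eq_div_iff this, h3]
    have : χ.1 t = (((4 / (∑ χ, (n χ : ℝ) ^ 2)) / 2 * n χ : ℝ) : ℂ) := by
      rw [happ, h4]; push_cast; rfl
    change (χ.1 t).im = 0
    rw [this, Complex.ofReal_im]

lemma pair_im {μ ν : Dual ℂ H} (hμ : μ ∈ hR H) (hν : ν ∈ hR H) : (pair μ ν).im = 0 := by
  simp [pair_eq_sum, root_apply_im hμ, root_apply_im hν]

lemma eq_zero_of_pair_self {μ : Dual ℂ H} (hμ : μ ∈ hR H) (h : pair μ μ = 0) : μ = 0 := by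
  have h' := congrArg Complex.re h
  simp only [pair_eq_sum, Complex.re_sum, Complex.mul_re, root_apply_im hμ, mul_zero, sub_zero,
    Complex.zero_re] at h'
  rw [Finset.sum_eq_zero_iff_of_nonneg fun _ _ => mul_self_nonneg _] at h'
  have h0 : ∀ χ : H.root, χ.1 ((cartanEquivDual H).symm μ) = 0 := fun χ =>
    Complex.ext (by simpa using h' χ (Finset.mem_univ _)) (root_apply_im hμ χ)
  have : (cartanEquivDual H) ((cartanEquivDual H).symm μ) = 0 := by
    ext y
    have h5 := pair_eq_sum μ (cartanEquivDual H y)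
    simp only [h0, zero_mul, Finset.sum_const_zero] at h5
    rw [pair, LinearEquiv.symm_apply_apply] at h5
    rw [cartanEquivDual_apply_apply]
    exact h5
  simpa using this

variable (H) in
/-- `t*_ℝ`: the orthogonal complement of `h(s)*_ℝ` in `h*_ℝ`. -/
def tR (m : LieSubalgebra ℂ L) : Submodule ℝ (Dual ℂ H) where
  carrier := {γ | γ ∈ hR H ∧ ∀ μ ∈ hsR H m, pair μ γ = 0}
  zero_mem' := ⟨Submodule.zero_mem _, by simp [pair]⟩
  add_mem' h h' := ⟨Submodule.add_mem _ h.1 h'.1, fun μ hμ => by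
    rw [pair_add_right, h.2 μ hμ, h'.2 μ hμ, add_zero]⟩
  smul_mem' c _ h := ⟨Submodule.smul_mem _ c h.1, fun μ hμ => by
    rw [pair_smul_right, h.2 μ hμ, mul_zero]⟩

lemma hsR_le_hR (m : LieSubalgebra ℂ L) : hsR H m ≤ hR H :=
  Submodule.span_mono (Set.image_mono (Set.subset_univ _))

lemma root_mem_hR (φ : H.root) : (rootSystem H).root φ ∈ hR H :=
  Submodule.subset_span ⟨φ, trivial, rfl⟩

/-- Every element of `h*_ℝ` has a unique decomposition `γ = γ_t + γ_s` with `γ_t ∈ t*_ℝ` and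
`γ_s ∈ h(s)*_ℝ`. -/
lemma existsUnique_component (m : LieSubalgebra ℂ L) {γ : Dual ℂ H} (hγ : γ ∈ hR H) :
    ∃! τ : Dual ℂ H, τ ∈ tR H m ∧ γ - τ ∈ hsR H m := by
  have hfin : FiniteDimensional ℝ (hR H) :=
    FiniteDimensional.span_of_finite ℝ (Set.toFinite _)
  let B : LinearMap.BilinForm ℝ (hR H) := LinearMap.mk₂ ℝ (fun x y => (pair x.1 y.1).re)
    (fun x y z => by simp [pair_comm _ z.1, pair_add_right])
    (fun c x y => by simp [pair_comm _ y.1, pair_smul_right])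
    (fun x y z => by simp [pair_add_right])
    (fun c x y => by simp [pair_smul_right])
  have hB : ∀ x y, B x y = (pair x.1 y.1).re := fun _ _ => rfl
  have hBr : B.IsRefl := fun x y h => by rw [hB, pair_comm]; exact h
  have key : ∀ x : hR H, B x x = 0 → x = 0 := fun x hx =>
    Subtype.ext (eq_zero_of_pair_self x.2 (Complex.ext hx (pair_im x.2 x.2)))
  let W : Submodule ℝ (hR H) := (hsR H m).comap (hR H).subtype
  have hW : IsCompl W (B.orthogonal W) := by
    rw [LinearMap.BilinForm.isCompl_orthogonal_iff_disjoint hBr, Submodule.disjoint_def]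
    intro x hx hx'
    exact key x (LinearMap.BilinForm.mem_orthogonal_iff.mp hx' x hx)
  obtain ⟨w, hw, v, hv, hwv⟩ : ∃ w ∈ W, ∃ v ∈ B.orthogonal W, w + v = (⟨γ, hγ⟩ : hR H) :=
    Submodule.mem_sup.mp (hW.sup_eq_top ▸ Submodule.mem_top)
  have hwv' : γ = w.1 + v.1 := (congrArg Subtype.val hwv).symm
  refine ⟨v.1, ⟨⟨v.2, fun μ hμ => ?_⟩, ?_⟩, ?_⟩
  · exact Complex.ext (LinearMap.BilinForm.mem_orthogonal_iff.mp hv ⟨μ, hsR_le_hR m hμ⟩ hμ)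
      (pair_im (hsR_le_hR m hμ) v.2)
  · rw [hwv', add_sub_cancel_right]; exact hw
  · rintro τ ⟨hτ, hτ'⟩
    have h1 : τ - v.1 ∈ hsR H m := by
      have : τ - v.1 = w.1 - (γ - τ) := by rw [hwv']; abel
      rw [this]
      exact Submodule.sub_mem _ hw hτ'
    have h2 : v.1 ∈ tR H m := ⟨v.2, fun μ hμ =>
      Complex.ext (LinearMap.BilinForm.mem_orthogonal_iff.mp hv ⟨μ, hsR_le_hR m hμ⟩ hμ)
      (pair_im (hsR_le_hR m hμ) v.2)⟩
    have h3 := (Submodule.sub_mem _ hτ h2).2 _ h1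
    exact sub_eq_zero.mp (eq_zero_of_pair_self (hsR_le_hR m h1) h3)

/-- `φ_t`: the component of the root `φ` in `t*_ℝ` along `h(s)*_ℝ`. -/
def tComponent (m : LieSubalgebra ℂ L) (φ : H.root) : Dual ℂ H :=
  (existsUnique_component m (root_mem_hR φ)).choose

/-! ### `t`-roots -/

variable (H) in
/-- The dual of `t`, embedded in the dual of `H` as the functionals vanishing on `h(s)`. -/
def tDual (m : LieSubalgebra ℂ L) : Submodule ℂ (Dual ℂ H) :=
  (cartanDerived H m).dualAnnihilator

/-- `g_ν = {z | [x, z] = ν(x) z for all x ∈ t}`. -/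
def tWeightSpace (m : LieSubalgebra ℂ L) (ν : Dual ℂ H) : Submodule ℂ L where
  carrier := {z | ∀ x : H, (x : L) ∈ leviCenter m → ⁅(x : L), z⁆ = ν x • z}
  zero_mem' := by simp
  add_mem' h h' x hx := by rw [lie_add, h x hx, h' x hx, smul_add]
  smul_mem' c _ h x hx := by rw [lie_smul, h x hx, smul_comm]

variable (H) in
/-- The set `R` of `t`-roots. -/
def tRoots (m : LieSubalgebra ℂ L) : Set (Dual ℂ H) :=
  {ν | ν ∈ tDual H m ∧ ν ≠ 0 ∧ tWeightSpace m ν ≠ ⊥}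

/-- An ordered basis of `t*_ℝ` that is orthogonal and has `δ_n` as its first element. -/
structure IsAdmissible {q m : LieSubalgebra ℂ L} (hHq : H ≤ q) {k : ℕ}
    (e : Basis (Fin (k + 1)) ℝ (tR H m)) : Prop where
  orthogonal : ∀ i j, i ≠ j → pair (e i : Dual ℂ H) (e j) = 0
  first : (e 0 : Dual ℂ H) = deltaN q hHq

/-- The set `R_+` of `t`-roots that are positive in the lexicographic ordering with respect to the
ordered basis `e` of `t*_ℝ`: the first nonzero coordinate is positive. -/
def posRoots {m : LieSubalgebra ℂ L} {k : ℕ} (e : Basis (Fin (k + 1)) ℝ (tR H m)) :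
    Set (Dual ℂ H) :=
  {ν | ν ∈ tRoots H m ∧ ∃ v : tR H m, (v : Dual ℂ H) = ν ∧
    ∃ i, (∀ j < i, e.repr v j = 0) ∧ 0 < e.repr v i}

/-- The simple elements of a set `P` of (positive `t`-)roots: those that are not a sum of two
elements of `P`. -/
def simpleRoots (P : Set (Dual ℂ H)) : Set (Dual ℂ H) :=
  {ν | ν ∈ P ∧ ¬ ∃ ν₁ ∈ P, ∃ ν₂ ∈ P, ν = ν₁ + ν₂}

/-- An enumeration `α_1, …, α_{ℓ(t)}, α_{ℓ(t)+1}, …, α_{ℓ(t)+ℓ(s)}` of the simple roots, where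
`ℓ(t) = dim t` and `ℓ(s) = dim h(s)`, whose last `ℓ(s)` members are roots of `s`. -/
structure SimpleOrdering (b : (rootSystem H).Base) (m : LieSubalgebra ℂ L) where
  toEquiv : Fin (finrank ℂ (leviCenter m)) ⊕ Fin (finrank ℂ (cartanDerived H m)) ≃ b.support
  mem_derived : ∀ i, (toEquiv (.inr i) : H.root) ∈ rootsIn H (leviDerived m)

/-- `α_j` for `j = 1, …, ℓ(t)`. -/
def SimpleOrdering.root {b : (rootSystem H).Base} {m : LieSubalgebra ℂ L}
    (α : SimpleOrdering b m) (j : Fin (finrank ℂ (leviCenter m))) : H.root :=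
  α.toEquiv (.inl j)

/-- `β_j = (α_j)_t` for `j = 1, …, ℓ(t)`. -/
def SimpleOrdering.beta {b : (rootSystem H).Base} {m : LieSubalgebra ℂ L}
    (α : SimpleOrdering b m) (j : Fin (finrank ℂ (leviCenter m))) : Dual ℂ H :=
  tComponent m (α.root j)

end

end LeviRoots

open LieAlgebra LieAlgebra.IsKilling Module

namespace LeviRoots

noncomputable section

set_option linter.unusedSectionVars false

variable {L : Type*} [LieRing L] [LieAlgebra ℂ L] [FiniteDimensional ℂ L]
  [LieAlgebra.IsSemisimple ℂ L] {H : LieSubalgebra ℂ L} [H.IsCartanSubalgebra]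

/-! ### Root vectors and coordinates -/

/-! Call a simple root outer if the root vector of its negative is not in `q`, inner otherwise, and
let the level of a root be the sum of its coefficients at the outer simple roots. Level is additive,
and its sign controls everything: the roots of `q` have level at least `0`
(`rootVector_mem_parabolic_iff`), the nilradical is spanned by the root vectors of positive level
(`nilradical_eq`), and the Levi factor has exactly the roots of level `0`
(`rootVector_mem_levi_iff`). Hence `t` is the common kernel of the inner simple roots and `h(s)` is
dual to their span, which gives the two dimensions.

Inner simple roots have zero component along `t`, so `φ_t` is the combination of the `α_t`, `α`
outer, with the coefficients of `φ` (`tComponent_eq_sum`). Independence of the simple roots makes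
these `α_t` a basis of `t*_ℝ`. Their mutual products are nonpositive because projecting adds a
nonnegative combination of inner simple roots to `α`, and distinct simple roots have nonpositive
products.

For the ordering, `δ_n` is the sum of the roots of positive level, and a reflection argument
(`sum_pairingIn_eq`) shows that `(δ_n, φ)` has the sign of the level of `φ`. The first lexicographic
coordinate therefore already decides positivity, and the positive `t`-roots are the `φ_t` with `φ`
of positive level (`mem_posRoots_iff`). Level is determined by `φ_t`, so an `α_t` with `α` outer, of
level `1`, is not a sum of two positive `t`-roots. Building a positive root up by simple roots shows
that every other positive `t`-root is such a sum. -/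

/-- A chosen nonzero vector of the root space of `φ`. -/
def rootVector (φ : H.root) : L := φ.1.exists_ne_zero.choose

lemma rootVector_mem (φ : H.root) : rootVector φ ∈ rootSpace H φ.1 :=
  φ.1.exists_ne_zero.choose_spec.1

lemma rootVector_ne_zero (φ : H.root) : rootVector φ ≠ 0 :=
  φ.1.exists_ne_zero.choose_spec.2

lemma exists_eq_smul_rootVector {φ : H.root} {x : L} (hx : x ∈ rootSpace H φ.1) :
    ∃ c : ℂ, x = c • rootVector φ := by
  obtain ⟨c, hc⟩ := (finrank_eq_one_iff_of_nonzero' (⟨rootVector φ, rootVector_mem φ⟩ :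
    rootSpace H φ.1) (by simpa [Subtype.ext_iff] using rootVector_ne_zero φ)).mp
    (finrank_rootSpace_eq_one φ.1 (H.isNonZero_coe_root φ)) ⟨x, hx⟩
  exact ⟨c, (congrArg Subtype.val hc).symm⟩

lemma mem_rootsIn_iff {φ : H.root} {U : Submodule ℂ L} :
    φ ∈ rootsIn H U ↔ rootVector φ ∈ U := by
  refine ⟨fun h => h (rootVector_mem φ), fun h x hx => ?_⟩
  obtain ⟨c, rfl⟩ := exists_eq_smul_rootVector hx
  exact U.smul_mem c h

lemma lie_rootVector (h : H) (φ : H.root) : ⁅(h : L), rootVector φ⁆ = φ.1 h • rootVector φ :=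
  lie_eq_smul_of_mem_rootSpace (rootVector_mem φ) h

/-- The negative of a root. -/
def negRoot (φ : H.root) : H.root :=
  ⟨-φ.1, by simpa using H.isNonZero_coe_root φ⟩

lemma root_negRoot (φ : H.root) : (rootSystem H).root (negRoot φ) = -(rootSystem H).root φ := rfl

lemma negRoot_apply (φ : H.root) (h : H) : (negRoot φ).1 h = -φ.1 h := rfl

lemma root_apply_eq (φ : H.root) (h : H) : (rootSystem H).root φ h = φ.1 h := rfl

lemma negRoot_negRoot (φ : H.root) : negRoot (negRoot φ) = φ :=
  (rootSystem H).root.injective (by rw [root_negRoot, root_negRoot, neg_neg])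

lemma killingForm_rootVector_negRoot_ne_zero (φ : H.root) :
    killingForm ℂ L (rootVector φ) (rootVector (negRoot φ)) ≠ 0 := by
  intro h0
  have : rootVector φ ∈ LinearMap.ker (killingForm ℂ L) := by
    refine mem_ker_killingForm_of_mem_rootSpace_of_forall_rootSpace_neg ℂ L H
      (rootVector_mem φ) fun y hy => ?_
    obtain ⟨c, rfl⟩ := exists_eq_smul_rootVector (φ := negRoot φ) hy
    rw [map_smul, h0, smul_zero]
  exact rootVector_ne_zero φ (by simpa using this)

lemma killingForm_rootVector_of_ne {φ ψ : H.root} (h : ψ ≠ negRoot φ) :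
    killingForm ℂ L (rootVector φ) (rootVector ψ) = 0 := by
  refine killingForm_apply_eq_zero_of_mem_rootSpace_of_add_ne_zero ℂ L H
    (rootVector_mem φ) (rootVector_mem ψ) fun h0 => h ?_
  apply (rootSystem H).root.injective
  ext x
  rw [root_negRoot]
  have := congrFun h0 x
  simp only [Pi.add_apply, Pi.zero_apply] at this
  exact eq_neg_of_add_eq_zero_right this

lemma killingForm_cartan_rootVector (h : H) (φ : H.root) :
    killingForm ℂ L (h : L) (rootVector φ) = 0 := by
  refine killingForm_apply_eq_zero_of_mem_rootSpace_of_add_ne_zero ℂ L H (α := 0)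
    (toLieSubmodule_le_rootSpace_zero ℂ L H h.2) (rootVector_mem φ) fun h0 => ?_
  rw [zero_add] at h0
  exact H.isNonZero_coe_root φ h0

lemma lie_rootVector_negRoot (φ : H.root) : ∃ c : ℂ, c ≠ 0 ∧
    ⁅rootVector φ, rootVector (negRoot φ)⁆ =
      c • ((cartanEquivDual H).symm ((rootSystem H).root φ) : L) :=
  ⟨_, killingForm_rootVector_negRoot_ne_zero φ,
    lie_eq_killingForm_smul_of_mem_rootSpace_of_mem_rootSpace_neg (rootVector_mem φ)
      (rootVector_mem (negRoot φ))⟩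

lemma lie_rootVector_mem (φ ψ : H.root) :
    ⁅rootVector φ, rootVector ψ⁆ ∈ rootSpace H (φ.1 + ψ.1 : H → ℂ) :=
  lie_mem_genWeightSpace_of_mem_genWeightSpace (rootVector_mem φ) (rootVector_mem ψ)

lemma lie_rootVector_eq_zero_or (φ ψ : H.root) :
    ⁅rootVector φ, rootVector ψ⁆ = 0 ∨ ψ = negRoot φ ∨
      ∃ χ, (rootSystem H).root χ = (rootSystem H).root φ + (rootSystem H).root ψ := by
  by_contra! hc
  obtain ⟨h1, h2, h3⟩ := hc
  have hne : rootSpace H (φ.1 + ψ.1 : H → ℂ) ≠ ⊥ := fun h0 => h1 (by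
    have := lie_rootVector_mem φ ψ
    rwa [h0, LieSubmodule.mem_bot] at this)
  let W : LieModule.Weight ℂ H L := ⟨_, hne⟩
  have hW : W.IsNonZero := fun h0 => h2 (by
    apply (rootSystem H).root.injective
    ext x
    rw [root_negRoot]
    exact eq_neg_of_add_eq_zero_right (congrFun h0 x))
  refine h3 ⟨W, by simpa [LieSubalgebra.root] using hW⟩ ?_
  ext x
  rfl

/-- Representation theory of `sl₂`: the `φ`-chain through `ψ` is generated from its top vector `x`
by `f`, and `e` acts without kernel below the top. This is what lets membership of root vectors in
`q` propagate to sums of roots. -/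
lemma lie_rootVector_of_add {φ ψ χ : H.root}
    (h : (rootSystem H).root χ = (rootSystem H).root φ + (rootSystem H).root ψ) :
    ∃ c : ℂ, c ≠ 0 ∧ ⁅rootVector φ, rootVector ψ⁆ = c • rootVector χ := by
  have hχ : (χ.1 : H → ℂ) = φ.1 + ψ.1 := by
    ext x
    exact LinearMap.congr_fun h x
  obtain ⟨c, hc⟩ := exists_eq_smul_rootVector (φ := χ) (hχ ▸ lie_rootVector_mem φ ψ)
  refine ⟨c, ?_, hc⟩
  rintro rfl
  rw [zero_smul] at hc
  have hα := H.isNonZero_coe_root φ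
  -- Since `φ + ψ` is a root, `ψ` is not the top of its chain.
  obtain ⟨k, hk⟩ : ∃ k, LieModule.chainTopCoeff φ.1 ψ.1 = k + 1 := by
    have := ((rootSpace_zsmul_add_ne_bot_iff φ.1 ψ.1 hα 1).mp (by
      rw [one_smul, ← hχ]; exact χ.1.2)).1
    exact ⟨LieModule.chainTopCoeff φ.1 ψ.1 - 1, by lia⟩
  have hkl := chainTopCoeff_le_chainLength φ.1 ψ.1
  obtain ⟨x, hx, x_ne0⟩ := (LieModule.chainTop φ.1 ψ.1).exists_ne_zero
  obtain ⟨h, e, f, isSl2, he, hf⟩ := exists_isSl2Triple_of_weight_isNonZero hα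
  obtain rfl := isSl2.h_eq_coroot hα he hf
  have prim : isSl2.HasPrimitiveVectorWith x (chainLength φ.1 ψ.1 : ℂ) :=
    have := lie_mem_genWeightSpace_of_mem_genWeightSpace he hx
    ⟨x_ne0, (chainLength_smul _ _ hx).symm, by
      rwa [LieModule.genWeightSpace_add_chainTop _ _ hα] at this⟩
  -- This is `e f^(k+1) x = (k+1)(μ-k) f^k x` with `μ` the chain length. The left side is a multiple
  -- of the bracket assumed to vanish; the right side is nonzero because `k < μ`.
  have h1 := prim.lie_e_pow_succ_toEnd_f k
  have h2 : (LieModule.toEnd ℂ L L f ^ (k + 1)) x ∈ rootSpace H ψ.1 := by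
    have := toEnd_pow_apply_mem hf hx (k + 1)
    have h3 : ((k + 1) • (-φ.1 : H → ℂ) + (LieModule.chainTop φ.1 ψ.1 : H → ℂ)) = ψ.1 := by
      rw [LieModule.coe_chainTop', hk, smul_neg, neg_add_cancel_left]
    rwa [h3] at this
  obtain ⟨a, rfl⟩ := exists_eq_smul_rootVector (φ := φ) he
  obtain ⟨b, hb⟩ := exists_eq_smul_rootVector h2
  rw [hb, smul_lie, lie_smul, hc, smul_zero, smul_zero, eq_comm, smul_eq_zero] at h1
  rcases h1 with h1 | h1
  · rcases mul_eq_zero.mp h1 with h1 | h1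
    · exact Nat.cast_add_one_ne_zero k h1
    · rw [sub_eq_zero, Nat.cast_inj] at h1
      lia
  · exact prim.pow_toEnd_f_ne_zero_of_eq_nat rfl (by lia) h1

/-- The coordinate along `rootVector φ` in the root space decomposition. -/
def rootCoord (φ : H.root) : L →ₗ[ℂ] ℂ :=
  (killingForm ℂ L (rootVector φ) (rootVector (negRoot φ)))⁻¹ •
    (killingForm ℂ L).flip (rootVector (negRoot φ))

lemma rootCoord_apply (φ : H.root) (x : L) : rootCoord φ x =
    (killingForm ℂ L (rootVector φ) (rootVector (negRoot φ)))⁻¹ *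
      killingForm ℂ L x (rootVector (negRoot φ)) := rfl

lemma rootCoord_self (φ : H.root) : rootCoord φ (rootVector φ) = 1 := by
  rw [rootCoord_apply, inv_mul_cancel₀ (killingForm_rootVector_negRoot_ne_zero φ)]

lemma rootCoord_of_ne {φ ψ : H.root} (h : ψ ≠ φ) : rootCoord φ (rootVector ψ) = 0 := by
  rw [rootCoord_apply, killingForm_rootVector_of_ne (φ := ψ), mul_zero]
  intro h'
  exact h (by rw [← negRoot_negRoot ψ, ← h', negRoot_negRoot])

lemma rootCoord_cartan (φ : H.root) (h : H) : rootCoord φ (h : L) = 0 := by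
  rw [rootCoord_apply, killingForm_cartan_rootVector, mul_zero]

lemma rootCoord_lie (φ : H.root) (h : H) (x : L) :
    rootCoord φ ⁅(h : L), x⁆ = φ.1 h * rootCoord φ x := by
  rw [rootCoord_apply, rootCoord_apply, ← lie_skew, map_neg, LinearMap.neg_apply,
    LieModule.traceForm_apply_lie_apply, lie_rootVector, negRoot_apply, map_smul, smul_eq_mul]
  ring

lemma sub_sum_rootCoord_mem (x : L) : x - ∑ φ : H.root, rootCoord φ x • rootVector φ ∈ H := by
  have hx : x ∈ H.toLieSubmodule ⊔
      ⨆ α : LieModule.Weight ℂ H L, ⨆ (_ : α.IsNonZero), rootSpace H α := by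
    rw [cartan_sup_iSup_rootSpace_eq_top]; trivial
  let T : L →ₗ[ℂ] L := LinearMap.id - ∑ φ : H.root, (rootCoord φ).smulRight (rootVector φ)
  have hT : ∀ y, T y = y - ∑ φ : H.root, rootCoord φ y • rootVector φ := fun y => by simp [T]
  rw [← hT]
  change x ∈ H.toSubmodule.comap T
  rw [← LieSubmodule.mem_toSubmodule] at hx
  suffices h : ((H.toLieSubmodule ⊔ ⨆ α : LieModule.Weight ℂ H L, ⨆ (_ : α.IsNonZero),
      rootSpace H α : LieSubmodule ℂ H L) : Submodule ℂ L) ≤ H.toSubmodule.comap T from h hx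
  simp only [LieSubmodule.sup_toSubmodule, LieSubmodule.iSup_toSubmodule]
  refine sup_le (fun y hy => ?_) (iSup₂_le fun α hα y hy => ?_)
  · rw [Submodule.mem_comap, hT]
    lift y to H using hy
    simp [rootCoord_cartan]
  · obtain ⟨c, rfl⟩ := exists_eq_smul_rootVector (φ := ⟨α, by simpa using hα⟩) hy
    rw [Submodule.mem_comap, map_smul, hT, Finset.sum_eq_single_of_mem _ (Finset.mem_univ _)
      (fun ψ _ hψ => by rw [rootCoord_of_ne hψ.symm, zero_smul]), rootCoord_self]
    simp

lemma exists_eq_add_sum (x : L) :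
    ∃ h : H, x = h + ∑ φ : H.root, rootCoord φ x • rootVector φ :=
  ⟨⟨_, sub_sum_rootCoord_mem x⟩, by simp⟩

lemma mem_cartan_of_rootCoord_eq_zero {x : L} (hx : ∀ φ : H.root, rootCoord φ x = 0) : x ∈ H := by
  simpa [hx] using sub_sum_rootCoord_mem (H := H) x

/-- A subspace that is stable under the Cartan subalgebra contains the root vectors along which
one of its elements has a nonzero coordinate. -/
lemma rootVector_mem_of_rootCoord_ne_zero {U : Submodule ℂ L}
    (hU : ∀ h : H, ∀ x ∈ U, ⁅(h : L), x⁆ ∈ U) {x : L} (hx : x ∈ U) {φ : H.root}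
    (hφ : rootCoord φ x ≠ 0) : rootVector φ ∈ U := by
  by_contra hn
  let N : LieSubmodule ℂ H L := { U with lie_mem := fun {h x} hx => hU h x hx }
  -- A stable subspace is the sum of its intersections with the weight spaces, and if `rootVector φ`
  -- were missing, `rootCoord φ` would kill each of them.
  have hN : N ≤ ⨆ χ : LieModule.Weight ℂ H L, N ⊓ LieModule.genWeightSpace L χ :=
    (LieModule.eq_iSup_inf_genWeightSpace ℂ H L N).le
  have hN' : (N : Submodule ℂ L) ≤ LinearMap.ker (rootCoord φ) := by
    refine (LieSubmodule.toSubmodule_le_toSubmodule _ _ |>.mpr hN).trans ?_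
    rw [LieSubmodule.iSup_toSubmodule]
    refine iSup_le fun χ y hy => ?_
    obtain ⟨hy1, hy2⟩ := hy
    rw [LinearMap.mem_ker]
    by_cases h0 : χ.IsZero
    · have : y ∈ H.toLieSubmodule := by
        have h := hy2
        rw [h0] at h
        simpa using h
      exact rootCoord_cartan φ ⟨y, this⟩
    · obtain ⟨c, rfl⟩ := exists_eq_smul_rootVector (φ := ⟨χ, by simpa using h0⟩) hy2
      by_cases hχ : (⟨χ, by simpa using h0⟩ : H.root) = φ
      · rw [hχ] at hy1 ⊢
        by_cases hc : c = 0
        · simp [hc]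
        · exact absurd ((U.smul_mem_iff hc).mp hy1) hn
      · rw [map_smul, rootCoord_of_ne hχ, smul_zero]
  exact hφ (hN' hx)

lemma rootCoord_eq_zero_of_mem_span {S : Set H.root} {φ : H.root} (hφ : φ ∉ S) {x : L}
    (hx : x ∈ Submodule.span ℂ (rootVector '' S)) : rootCoord φ x = 0 := by
  have : Submodule.span ℂ (rootVector '' S) ≤ LinearMap.ker (rootCoord φ) := by
    rw [Submodule.span_le]
    rintro _ ⟨ψ, hψ, rfl⟩
    exact rootCoord_of_ne (fun h => hφ (h ▸ hψ))
  exact this hx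

lemma linearIndependent_rootVector : LinearIndependent ℂ (rootVector (H := H)) := by
  rw [Fintype.linearIndependent_iff]
  intro c hc φ
  have := congrArg (rootCoord φ) hc
  rwa [map_sum, Finset.sum_eq_single_of_mem φ (Finset.mem_univ _)
    (fun ψ _ hψ => by rw [map_smul, rootCoord_of_ne hψ, smul_zero]), map_smul, rootCoord_self,
    map_zero, smul_eq_mul, mul_one] at this

/-! ### Coefficients with respect to the simple roots -/

section Coefficients

variable (b : (rootSystem H).Base)

lemma root_eq_sum_simpleCoeff (φ : H.root) : (rootSystem H).root φ =
    ∑ α ∈ b.support, simpleCoeff b α φ • (rootSystem H).root α :=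
  (b.exists_root_eq_sum_int φ).choose_spec.2.2

lemma eq_of_sum_simple_eq {f g : H.root → ℂ}
    (h : ∑ α ∈ b.support, f α • (rootSystem H).root α =
      ∑ α ∈ b.support, g α • (rootSystem H).root α) {α : H.root} (hα : α ∈ b.support) :
    f α = g α := by
  have h1 : ∑ α ∈ b.support, (f α - g α) • (rootSystem H).root α = 0 := by
    simp_rw [sub_smul, Finset.sum_sub_distrib, h, sub_self]
  exact sub_eq_zero.mp (linearIndepOn_iff'.mp b.linearIndepOn_root b.support (fun α => f α - g α)
    subset_rfl h1 α hα)

variable {b}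

lemma simpleCoeff_eq {φ : H.root} {f : H.root → ℤ}
    (h : (rootSystem H).root φ = ∑ α ∈ b.support, f α • (rootSystem H).root α)
    {α : H.root} (hα : α ∈ b.support) : simpleCoeff b α φ = f α := by
  have := eq_of_sum_simple_eq b (f := fun α => (simpleCoeff b α φ : ℂ)) (g := fun α => (f α : ℂ))
    (by simp_rw [Int.cast_smul_eq_zsmul]; rw [← h, ← root_eq_sum_simpleCoeff]) hα
  exact_mod_cast this

lemma simpleCoeff_of_eq_add_zsmul {φ ψ χ : H.root} {z : ℤ}
    (h : (rootSystem H).root χ = (rootSystem H).root φ + z • (rootSystem H).root ψ)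
    {α : H.root} (hα : α ∈ b.support) :
    simpleCoeff b α χ = simpleCoeff b α φ + z * simpleCoeff b α ψ := by
  refine simpleCoeff_eq (f := fun α => simpleCoeff b α φ + z * simpleCoeff b α ψ) ?_ hα
  rw [h]
  conv_lhs => rw [root_eq_sum_simpleCoeff b φ, root_eq_sum_simpleCoeff b ψ]
  rw [Finset.smul_sum, ← Finset.sum_add_distrib]
  exact Finset.sum_congr rfl fun _ _ => by rw [add_smul, mul_smul]

lemma simpleCoeff_self {α : H.root} (hα : α ∈ b.support) : simpleCoeff b α α = 1 := by
  classical
  have := simpleCoeff_eq (b := b) (φ := α) (f := Pi.single α 1) (by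
    rw [Finset.sum_eq_single_of_mem α hα (fun β _ h => by
      rw [Pi.single_eq_of_ne h, zero_smul]), Pi.single_eq_same, one_smul]) hα
  rwa [Pi.single_eq_same] at this

lemma simpleCoeff_of_ne {α β : H.root} (hα : α ∈ b.support) (hβ : β ∈ b.support) (h : α ≠ β) :
    simpleCoeff b α β = 0 := by
  classical
  have := simpleCoeff_eq (b := b) (φ := β) (f := Pi.single β 1) (by
    rw [Finset.sum_eq_single_of_mem β hβ (fun β _ h => by
      rw [Pi.single_eq_of_ne h, zero_smul]), Pi.single_eq_same, one_smul]) hα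
  rwa [Pi.single_eq_of_ne h] at this

lemma simpleCoeff_nonneg {φ : H.root} (h : b.IsPos φ) (α : H.root) : 0 ≤ simpleCoeff b α φ := by
  have hs := (b.exists_root_eq_sum_int φ).choose_spec
  rcases hs.2.1 with h1 | h1
  · exact h1.le α
  -- The height is the sum of these same coefficients, and positivity means positive height.
  · have : b.height φ ≤ 0 := Finset.sum_nonpos fun α _ => h1.le α
    exact absurd h (not_lt.mpr this)

lemma isPos_or_isPos_negRoot (φ : H.root) : b.IsPos φ ∨ b.IsPos (negRoot φ) := by
  have h1 := b.height_ne_zero φ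
  have h2 : b.height (negRoot φ) = b.height φ + (-2 : ℤ) • b.height φ :=
    -- The negative is written as `φ + (-2) φ`, to which additivity applies.
    b.height_add_zsmul (by rw [root_negRoot]; module)
  rw [RootPairing.Base.isPos_iff, RootPairing.Base.isPos_iff, h2, smul_eq_mul]
  lia

/-- The sum of the coefficients of `φ` at the simple roots in `J`. -/
def partialHeight (b : (rootSystem H).Base) (J : Finset H.root) (φ : H.root) : ℤ :=
  ∑ α ∈ J, simpleCoeff b α φ

variable {J : Finset H.root} (hJ : J ⊆ b.support)
include hJ

lemma partialHeight_of_eq_add_zsmul {φ ψ χ : H.root} {z : ℤ}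
    (h : (rootSystem H).root χ = (rootSystem H).root φ + z • (rootSystem H).root ψ) :
    partialHeight b J χ = partialHeight b J φ + z * partialHeight b J ψ := by
  rw [partialHeight, partialHeight, partialHeight, Finset.mul_sum, ← Finset.sum_add_distrib]
  exact Finset.sum_congr rfl fun α hα => simpleCoeff_of_eq_add_zsmul h (hJ hα)

lemma partialHeight_of_eq_add {φ ψ χ : H.root}
    (h : (rootSystem H).root χ = (rootSystem H).root φ + (rootSystem H).root ψ) :
    partialHeight b J χ = partialHeight b J φ + partialHeight b J ψ := by
  rw [partialHeight_of_eq_add_zsmul hJ (φ := φ) (ψ := ψ) (z := 1) (by rw [h, one_smul]), one_mul]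

lemma partialHeight_negRoot (φ : H.root) :
    partialHeight b J (negRoot φ) = -partialHeight b J φ := by
  rw [partialHeight_of_eq_add_zsmul hJ (φ := φ) (ψ := φ) (z := -2)
    (by rw [root_negRoot]; module)]
  ring

omit hJ in
lemma partialHeight_nonneg {φ : H.root} (h : b.IsPos φ) : 0 ≤ partialHeight b J φ :=
  Finset.sum_nonneg fun α _ => simpleCoeff_nonneg h α

lemma partialHeight_of_mem {α : H.root} (hα : α ∈ J) : partialHeight b J α = 1 := by
  rw [partialHeight, Finset.sum_eq_single_of_mem α hα
    (fun _ hβ h => simpleCoeff_of_ne (hJ hβ) (hJ hα) h), simpleCoeff_self (hJ hα)]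

lemma partialHeight_of_notMem {α : H.root} (hα : α ∈ b.support) (hα' : α ∉ J) :
    partialHeight b J α = 0 :=
  Finset.sum_eq_zero fun _ hβ => simpleCoeff_of_ne (hJ hβ) hα (fun h => hα' (h ▸ hβ))

lemma isPos_of_partialHeight_pos {φ : H.root} (h : 0 < partialHeight b J φ) : b.IsPos φ := by
  refine (isPos_or_isPos_negRoot φ).resolve_right fun h' => ?_
  have := partialHeight_nonneg (J := J) h'
  rw [partialHeight_negRoot hJ] at this
  lia

/-- All coefficients of a root have the same sign, so a vanishing partial sum has vanishing terms.
-/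
lemma simpleCoeff_eq_zero_of_partialHeight {φ : H.root} (h : partialHeight b J φ = 0)
    {α : H.root} (hα : α ∈ J) : simpleCoeff b α φ = 0 := by
  rcases isPos_or_isPos_negRoot (b := b) φ with hp | hp
  · exact (Finset.sum_eq_zero_iff_of_nonneg fun α _ => simpleCoeff_nonneg hp α).mp h α hα
  · have h1 := simpleCoeff_of_eq_add_zsmul (b := b) (χ := negRoot φ) (φ := φ) (ψ := φ) (z := -2)
      (by rw [root_negRoot]; module) (hJ hα)
    have h2 := (Finset.sum_eq_zero_iff_of_nonneg fun α _ => simpleCoeff_nonneg hp α).mp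
      (show partialHeight b J (negRoot φ) = 0 by rw [partialHeight_negRoot hJ, h, neg_zero]) α hα
    lia

end Coefficients

/-! ### The roots of a standard parabolic subalgebra, its nilradical and Levi factor -/

section Parabolic

variable {b : (rootSystem H).Base} {q m : LieSubalgebra ℂ L}

open Classical in
/-- The simple roots `α` such that the root space of `-α` does not lie in `q`. -/
def outerSimple (b : (rootSystem H).Base) (q : LieSubalgebra ℂ L) : Finset H.root :=
  {α ∈ b.support | rootVector (negRoot α) ∉ q}

/-- The sum of the coefficients of `φ` at the simple roots that are not roots of the Levi factor
of `q`. -/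
def level (b : (rootSystem H).Base) (q : LieSubalgebra ℂ L) (φ : H.root) : ℤ :=
  partialHeight b (outerSimple b q) φ

lemma mem_outerSimple {α : H.root} :
    α ∈ outerSimple b q ↔ α ∈ b.support ∧ rootVector (negRoot α) ∉ q := by
  classical
  simp [outerSimple]

lemma outerSimple_subset : outerSimple b q ⊆ b.support :=
  fun _ h => (mem_outerSimple.mp h).1

lemma rootVector_mem_of_isPos (hq : IsStandardParabolic b q) {φ : H.root} (h : b.IsPos φ) :
    rootVector φ ∈ q :=
  hq (Submodule.mem_sup_right (Submodule.mem_iSup_of_mem φ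
    (Submodule.mem_iSup_of_mem h (rootVector_mem φ))))

lemma rootVector_mem_of_add {φ ψ χ : H.root} (hφ : rootVector φ ∈ q) (hψ : rootVector ψ ∈ q)
    (h : (rootSystem H).root χ = (rootSystem H).root φ + (rootSystem H).root ψ) :
    rootVector χ ∈ q := by
  obtain ⟨c, hc, h'⟩ := lie_rootVector_of_add h
  exact (q.toSubmodule.smul_mem_iff hc).mp (h' ▸ q.lie_mem hφ hψ)

lemma level_of_mem {α : H.root} (hα : α ∈ outerSimple b q) : level b q α = 1 :=
  partialHeight_of_mem outerSimple_subset hα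

lemma level_of_notMem {α : H.root} (hα : α ∈ b.support) (hα' : α ∉ outerSimple b q) :
    level b q α = 0 :=
  partialHeight_of_notMem outerSimple_subset hα hα'

lemma rootVector_negRoot_mem_iff_of_mem_support {α : H.root} (hα : α ∈ b.support) :
    rootVector (negRoot α) ∈ q ↔ level b q α = 0 := by
  by_cases h : α ∈ outerSimple b q
  · simp [level_of_mem h, (mem_outerSimple.mp h).2]
  · have h' : rootVector (negRoot α) ∈ q := by
      by_contra hn
      exact h (mem_outerSimple.mpr ⟨hα, hn⟩)
    simp [level_of_notMem hα h, h']

/-- Induction on adding a simple root `α` to `φ`. If `-(φ + α)` is a root of `q`, bracketing with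
the positive root vectors of `α` and `φ` puts `-φ` and `-α` in `q`; the converse brackets these two.
Both levels are nonnegative, so their sum vanishes only if each does. -/
lemma rootVector_negRoot_mem_iff (hq : IsStandardParabolic b q) {φ : H.root} (h : b.IsPos φ) :
    rootVector (negRoot φ) ∈ q ↔ level b q φ = 0 := by
  -- Positivity is carried along because the induction step needs it for the smaller root.
  suffices b.IsPos φ ∧ (rootVector (negRoot φ) ∈ q ↔ level b q φ = 0) from this.2
  refine h.induction_on_add (p := fun φ =>
    b.IsPos φ ∧ (rootVector (negRoot φ) ∈ q ↔ level b q φ = 0)) (fun α hα => ?_)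
    fun φ α χ hχ hφ hα => ?_
  · exact ⟨b.isPos_of_mem_support hα, rootVector_negRoot_mem_iff_of_mem_support hα⟩
  · have hα' := b.isPos_of_mem_support hα
    refine ⟨hφ.1.add hα' hχ, ?_⟩
    have h1 : level b q χ = level b q φ + level b q α :=
      partialHeight_of_eq_add outerSimple_subset hχ
    have h2 : 0 ≤ level b q φ := partialHeight_nonneg hφ.1
    have h3 : 0 ≤ level b q α := partialHeight_nonneg hα'
    have h4 := rootVector_negRoot_mem_iff_of_mem_support (q := q) hα
    constructor
    · intro hm
      have h5 : rootVector (negRoot φ) ∈ q := rootVector_mem_of_add hm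
        (rootVector_mem_of_isPos hq hα') (by rw [root_negRoot, root_negRoot, hχ]; abel)
      have h6 : rootVector (negRoot α) ∈ q := rootVector_mem_of_add hm
        (rootVector_mem_of_isPos hq hφ.1) (by rw [root_negRoot, root_negRoot, hχ]; abel)
      rw [h1, hφ.2.mp h5, h4.mp h6, add_zero]
    · intro h0
      exact rootVector_mem_of_add (hφ.2.mpr (by lia)) (h4.mpr (by lia))
        (by rw [root_negRoot, root_negRoot, root_negRoot, hχ]; abel)

lemma level_negRoot (φ : H.root) : level b q (negRoot φ) = -level b q φ :=
  partialHeight_negRoot outerSimple_subset φ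

lemma rootVector_mem_parabolic_iff (hq : IsStandardParabolic b q) {φ : H.root} :
    rootVector φ ∈ q ↔ 0 ≤ level b q φ := by
  rcases isPos_or_isPos_negRoot (b := b) φ with hp | hp
  · exact iff_of_true (rootVector_mem_of_isPos hq hp) (partialHeight_nonneg hp)
  · have h1 := rootVector_negRoot_mem_iff hq hp
    rw [negRoot_negRoot, level_negRoot] at h1
    have h2 : 0 ≤ level b q (negRoot φ) := partialHeight_nonneg hp
    rw [level_negRoot] at h2
    rw [h1]
    lia

/-- The span of the root vectors of positive level. -/
def positiveLevel (b : (rootSystem H).Base) (q : LieSubalgebra ℂ L) : Submodule ℂ L :=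
  Submodule.span ℂ (rootVector '' {φ : H.root | 0 < level b q φ})

lemma exists_eq_add_sum_of_stable {U : Submodule ℂ L}
    (hU : ∀ h : H, ∀ x ∈ U, ⁅(h : L), x⁆ ∈ U) {x : L} (hx : x ∈ U) :
    ∃ h : H, (h : L) ∈ U ∧ x = h + ∑ φ : H.root, rootCoord φ x • rootVector φ := by
  obtain ⟨h, hh⟩ := exists_eq_add_sum (H := H) x
  refine ⟨h, ?_, hh⟩
  have : (h : L) = x - ∑ φ : H.root, rootCoord φ x • rootVector φ := eq_sub_of_add_eq hh.symm
  rw [this]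
  refine U.sub_mem hx (U.sum_mem fun φ _ => ?_)
  by_cases h0 : rootCoord φ x = 0
  · rw [h0, zero_smul]; exact U.zero_mem
  · exact U.smul_mem _ (rootVector_mem_of_rootCoord_ne_zero hU hx h0)

/-- Levels add under brackets of root vectors. -/
lemma lie_rootVector_mem_span_level {k l : ℤ} {φ ψ : H.root} (hφ : k ≤ level b q φ)
    (hψ : l ≤ level b q ψ) (hkl : 0 < k + l) : ⁅rootVector φ, rootVector ψ⁆ ∈
      Submodule.span ℂ (rootVector '' {χ : H.root | k + l ≤ level b q χ}) := by
  rcases lie_rootVector_eq_zero_or φ ψ with h | h | ⟨χ, hχ⟩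
  · rw [h]; exact Submodule.zero_mem _
  -- The hypothesis `0 < k + l` rules out opposite roots, whose bracket would lie in the Cartan
  -- subalgebra.
  · have := level_negRoot (b := b) (q := q) φ
    rw [← h] at this
    lia
  · obtain ⟨c, -, h⟩ := lie_rootVector_of_add hχ
    rw [h]
    refine Submodule.smul_mem _ _ (Submodule.subset_span ⟨χ, ?_, rfl⟩)
    have : level b q χ = level b q φ + level b q ψ := partialHeight_of_eq_add outerSimple_subset hχ
    change k + l ≤ level b q χ
    lia

lemma lie_mem_span_level {k l : ℤ} (hkl : 0 < k + l) {x y : L}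
    (hx : x ∈ Submodule.span ℂ (rootVector '' {χ : H.root | k ≤ level b q χ}))
    (hy : y ∈ Submodule.span ℂ (rootVector '' {χ : H.root | l ≤ level b q χ})) :
    ⁅x, y⁆ ∈ Submodule.span ℂ (rootVector '' {χ : H.root | k + l ≤ level b q χ}) := by
  induction hx using Submodule.span_induction with
  | zero => simp
  | add x x' _ _ h h' => rw [add_lie]; exact Submodule.add_mem _ h h'
  | smul c x _ h => rw [smul_lie]; exact Submodule.smul_mem _ _ h
  | mem x hx =>
    obtain ⟨φ, hφ, rfl⟩ := hx
    induction hy using Submodule.span_induction with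
    | zero => simp
    | add x x' _ _ h h' => rw [lie_add]; exact Submodule.add_mem _ h h'
    | smul c x _ h => rw [lie_smul]; exact Submodule.smul_mem _ _ h
    | mem y hy =>
      obtain ⟨ψ, hψ, rfl⟩ := hy
      exact lie_rootVector_mem_span_level hφ hψ hkl

lemma cartan_lie_mem_span (S : Set H.root) (h : H) {y : L}
    (hy : y ∈ Submodule.span ℂ (rootVector '' S)) :
    ⁅(h : L), y⁆ ∈ Submodule.span ℂ (rootVector '' S) := by
  induction hy using Submodule.span_induction with
  | zero => simp
  | add x x' _ _ h h' => rw [lie_add]; exact Submodule.add_mem _ h h'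
  | smul c x _ h => rw [lie_smul]; exact Submodule.smul_mem _ _ h
  | mem y hy =>
    obtain ⟨φ, hφ, rfl⟩ := hy
    rw [lie_rootVector]
    exact Submodule.smul_mem _ _ (Submodule.subset_span ⟨φ, hφ, rfl⟩)

lemma positiveLevel_le (hq : IsStandardParabolic b q) : positiveLevel b q ≤ q.toSubmodule := by
  rw [positiveLevel, Submodule.span_le]
  rintro _ ⟨φ, hφ, rfl⟩
  exact (rootVector_mem_parabolic_iff hq).mpr (le_of_lt hφ)

lemma lie_mem_of_cartan_le (hHq : H ≤ q) (h : H) (x : L) (hx : x ∈ q.toSubmodule) :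
    ⁅(h : L), x⁆ ∈ q.toSubmodule :=
  q.lie_mem (hHq h.2) hx

lemma positiveLevel_eq : positiveLevel b q =
    Submodule.span ℂ (rootVector '' {φ : H.root | 1 ≤ level b q φ}) := rfl

lemma lie_mem_positiveLevel (hq : IsStandardParabolic b q) {x y : L} (hx : x ∈ q)
    (hy : y ∈ positiveLevel b q) : ⁅x, y⁆ ∈ positiveLevel b q := by
  obtain ⟨h, hh, he⟩ := exists_eq_add_sum_of_stable (lie_mem_of_cartan_le hq.cartan_le) hx
  rw [he, add_lie]
  refine Submodule.add_mem _ (cartan_lie_mem_span _ h hy) ?_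
  have h2 : ∑ φ : H.root, rootCoord φ x • rootVector φ ∈
      Submodule.span ℂ (rootVector '' {φ : H.root | 0 ≤ level b q φ}) := by
    refine Submodule.sum_mem _ fun φ _ => ?_
    by_cases h0 : rootCoord φ x = 0
    · rw [h0, zero_smul]; exact Submodule.zero_mem _
    · exact Submodule.smul_mem _ _ (Submodule.subset_span ⟨φ, (rootVector_mem_parabolic_iff hq).mp
        (rootVector_mem_of_rootCoord_ne_zero (lie_mem_of_cartan_le hq.cartan_le) hx h0), rfl⟩)
  rw [positiveLevel_eq] at hy ⊢
  have := lie_mem_span_level (k := 0) (l := 1) (by norm_num) h2 hy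
  rwa [zero_add] at this

/-- The ideal of a standard parabolic subalgebra spanned by the root vectors of positive level. -/
def positiveLevelIdeal (hq : IsStandardParabolic b q) : LieIdeal ℂ q :=
  { (positiveLevel b q).comap q.toSubmodule.subtype with
    lie_mem := fun {x _} hm => lie_mem_positiveLevel hq x.2 hm }

lemma mem_positiveLevelIdeal (hq : IsStandardParabolic b q) {x : q} :
    x ∈ positiveLevelIdeal hq ↔ (x : L) ∈ positiveLevel b q := Iff.rfl

/-! ### Identification of the nilradical and of the roots of the Levi factor. -/

lemma exists_level_bound : ∃ N : ℕ, ∀ φ : H.root, level b q φ ≤ N := by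
  obtain ⟨N, hN⟩ := (Set.finite_range (level b q)).bddAbove
  exact ⟨N.toNat, fun φ => (hN ⟨φ, rfl⟩).trans (Int.self_le_toNat N)⟩

/-- By Engel's theorem it is enough that each `ad x` is nilpotent; it raises levels by at least `1`,
and levels are bounded. -/
lemma isNilpotent_positiveLevelIdeal (hq : IsStandardParabolic b q) :
    LieRing.IsNilpotent (positiveLevelIdeal hq) := by
  rw [LieAlgebra.isNilpotent_iff_forall (R := ℂ)]
  intro x
  obtain ⟨N, hN⟩ := exists_level_bound (b := b) (q := q)
  refine ⟨N, ?_⟩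
  ext y
  -- The extra `1` is the level `y` starts with, so `k = N` already exceeds the bound.
  have key : ∀ k : ℕ, ((((ad ℂ (positiveLevelIdeal hq) x ^ k) y : positiveLevelIdeal hq) : q) : L) ∈
      Submodule.span ℂ (rootVector '' {φ : H.root | (k : ℤ) + 1 ≤ level b q φ}) := by
    intro k
    induction k with
    | zero => simpa [positiveLevel] using! (mem_positiveLevelIdeal hq).mp y.2
    | succ k ih =>
      rw [pow_succ', Module.End.mul_apply, LieAlgebra.ad_apply]
      have := lie_mem_span_level (k := 1) (l := (k : ℤ) + 1) (by lia)
        ((mem_positiveLevelIdeal hq).mp x.2) ih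
      rwa [show (1 : ℤ) + ((k : ℤ) + 1) = ((k + 1 : ℕ) : ℤ) + 1 by push_cast; ring] at this
  have h0 : {φ : H.root | (N : ℤ) + 1 ≤ level b q φ} = ∅ := by
    ext φ
    have := hN φ
    simp only [Set.mem_ofPred_eq, Set.mem_empty_iff_false, iff_false]
    lia
  have := key N
  rw [h0, Set.image_empty, Submodule.span_empty, Submodule.mem_bot] at this
  exact this

lemma eq_zero_of_forall_isPos {h : H} (hh : ∀ φ : H.root, b.IsPos φ → φ.1 h = 0) : h = 0 := by
  suffices h ∈ ⨅ α : LieModule.Weight ℂ H L, α.ker by simpa [iInf_ker_weight_eq_bot] using this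
  refine (Submodule.mem_iInf _).mpr fun χ => ?_
  rw [LinearMap.mem_ker]
  by_cases h0 : χ.IsZero
  · exact congrFun h0 h
  · have h1 : χ ∈ H.root := by simpa using h0
    rcases isPos_or_isPos_negRoot (b := b) ⟨χ, h1⟩ with hp | hp
    · exact hh _ hp
    · simpa [negRoot_apply] using hh _ hp

lemma exists_pow_lie_eq_zero {I : LieIdeal ℂ q} (hI : LieRing.IsNilpotent I) {x y : q} (hx : x ∈ I)
    (hy : y ∈ I) : ∃ k : ℕ, (ad ℂ L (x : L) ^ k) (y : L) = 0 := by
  rw [LieAlgebra.isNilpotent_iff_forall (R := ℂ)] at hI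
  obtain ⟨k, hk⟩ := hI ⟨x, hx⟩
  refine ⟨k, ?_⟩
  have key : ∀ k : ℕ, (((ad ℂ I ⟨x, hx⟩ ^ k) ⟨y, hy⟩ : I) : L) = (ad ℂ L (x : L) ^ k) (y : L) := by
    intro k
    induction k with
    | zero => rfl
    | succ k ih =>
      rw [pow_succ', Module.End.mul_apply, pow_succ', Module.End.mul_apply, ← ih]
      rfl
  rw [← key, hk]
  rfl

/-- A nilpotent ideal contains no nonzero `h` of the Cartan subalgebra: some positive root has `φ h
≠ 0`, so its root vector is in the ideal and is an eigenvector of `ad h` with nonzero eigenvalue.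
Nor does it contain a root vector of level `0`: the opposite one lies in `q`, and their bracket is a
nonzero element of the Cartan subalgebra. -/
lemma le_positiveLevelIdeal (hq : IsStandardParabolic b q) {I : LieIdeal ℂ q}
    (hI : LieRing.IsNilpotent I) : I ≤ positiveLevelIdeal hq := by
  let V : Submodule ℂ L := I.toSubmodule.map q.toSubmodule.subtype
  have hV : ∀ {x : q}, (x : L) ∈ V ↔ x ∈ I := fun {x} => by simp [V]
  have hVq : ∀ {x : L}, x ∈ V → x ∈ q := by
    rintro _ ⟨x, -, rfl⟩; exact x.2
  have hlie : ∀ {x y : L}, x ∈ q → y ∈ V → ⁅x, y⁆ ∈ V := by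
    rintro x _ hx ⟨y, hy, rfl⟩
    exact ⟨⁅(⟨x, hx⟩ : q), y⁆, I.lie_mem hy, rfl⟩
  have hpow : ∀ {x y : L}, x ∈ V → y ∈ V → ∃ k : ℕ, (ad ℂ L x ^ k) y = 0 := by
    rintro _ _ ⟨x, hx, rfl⟩ ⟨y, hy, rfl⟩
    exact exists_pow_lie_eq_zero hI hx hy
  have hstable : ∀ h : H, ∀ x ∈ V, ⁅(h : L), x⁆ ∈ V := fun h x hx => hlie (hq.cartan_le h.2) hx
  have hcartan : ∀ h : H, (h : L) ∈ V → h = 0 := by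
    intro h hh
    refine eq_zero_of_forall_isPos (b := b) fun φ hφ => ?_
    by_contra h0
    have h1 : rootVector φ ∈ V := by
      have h2 := hlie (rootVector_mem_of_isPos hq hφ) hh
      rw [← lie_skew, lie_rootVector, ← smul_neg, V.smul_mem_iff h0, V.neg_mem_iff] at h2
      exact h2
    obtain ⟨k, hk⟩ := hpow hh h1
    have h3 : ∀ k : ℕ, (ad ℂ L (h : L) ^ k) (rootVector φ) = (φ.1 h) ^ k • rootVector φ := by
      intro k
      induction k with
      | zero => simp
      | succ k ih =>
        rw [pow_succ', Module.End.mul_apply, ih, map_smul, LieAlgebra.ad_apply, lie_rootVector,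
          smul_smul, pow_succ]
    rw [h3, smul_eq_zero] at hk
    exact hk.elim (pow_ne_zero k h0) (rootVector_ne_zero φ)
  have hlevel : ∀ φ : H.root, rootVector φ ∈ V → 0 < level b q φ := by
    intro φ hφ
    have h1 := (rootVector_mem_parabolic_iff hq).mp (hVq hφ)
    refine lt_of_le_of_ne h1 fun h2 => ?_
    have h3 : rootVector (negRoot φ) ∈ q := by
      rw [rootVector_mem_parabolic_iff hq, level_negRoot, ← h2, neg_zero]
    obtain ⟨c, hc, h4⟩ := lie_rootVector_negRoot φ
    have h5 := hlie h3 hφ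
    rw [← lie_skew, h4, V.neg_mem_iff, V.smul_mem_iff hc] at h5
    have h6 := hcartan _ h5
    rw [LinearEquiv.map_eq_zero_iff] at h6
    exact (rootSystem H).ne_zero φ h6
  intro x hx
  rw [mem_positiveLevelIdeal]
  obtain ⟨h, hh, he⟩ := exists_eq_add_sum_of_stable hstable (hV.mpr hx)
  rw [hcartan h hh, ZeroMemClass.coe_zero, zero_add] at he
  rw [he]
  refine Submodule.sum_mem _ fun φ _ => ?_
  by_cases h0 : rootCoord φ (x : L) = 0
  · rw [h0, zero_smul]; exact Submodule.zero_mem _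
  · exact Submodule.smul_mem _ _ (Submodule.subset_span ⟨φ, hlevel φ
      (rootVector_mem_of_rootCoord_ne_zero hstable (hV.mpr hx) h0), rfl⟩)

lemma nilradical_eq (hq : IsStandardParabolic b q) : nilradical q = positiveLevelIdeal hq :=
  le_antisymm (sSup_le fun _ hI => le_positiveLevelIdeal hq hI)
    (le_sSup (isNilpotent_positiveLevelIdeal hq))

lemma nilradicalSubmodule_eq (hq : IsStandardParabolic b q) :
    nilradicalSubmodule q = positiveLevel b q := by
  rw [nilradicalSubmodule, nilradical_eq hq]
  change ((positiveLevel b q).comap q.toSubmodule.subtype).map q.toSubmodule.subtype = _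
  rw [Submodule.map_comap_subtype, inf_eq_right]
  exact positiveLevel_le hq

/-- Positive levels are excluded because `m` meets the nilradical trivially. A root vector of level
`0` splits along `q = m ⊕ n`; the `n`-part has no coordinate along it, so the `m`-part does, and
stability of `m` under the Cartan subalgebra concludes. -/
lemma rootVector_mem_levi_iff (hq : IsStandardParabolic b q) (hm : IsLeviFactor q m) (hHm : H ≤ m)
    {φ : H.root} : rootVector φ ∈ m ↔ level b q φ = 0 := by
  have hn := nilradicalSubmodule_eq hq
  have h1 := hm.inf_eq_bot
  have h2 := hm.sup_eq
  rw [hn] at h1 h2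
  constructor
  · intro h
    have h3 : rootVector φ ∈ q := h2.le (Submodule.mem_sup_left h)
    rw [rootVector_mem_parabolic_iff hq] at h3
    refine (h3.lt_or_eq).elim (fun h4 => ?_) Eq.symm
    have h5 : rootVector φ ∈ m.toSubmodule ⊓ positiveLevel b q :=
      ⟨h, Submodule.subset_span ⟨φ, h4, rfl⟩⟩
    rw [h1, Submodule.mem_bot] at h5
    exact absurd h5 (rootVector_ne_zero φ)
  · intro h
    have h3 : rootVector φ ∈ m.toSubmodule ⊔ positiveLevel b q := by
      rw [h2]; exact (rootVector_mem_parabolic_iff hq).mpr h.ge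
    obtain ⟨y, hy, z, hz, hyz⟩ := Submodule.mem_sup.mp h3
    refine rootVector_mem_of_rootCoord_ne_zero (lie_mem_of_cartan_le hHm) hy (φ := φ) ?_
    have h4 : rootCoord φ z = 0 := rootCoord_eq_zero_of_mem_span (by simp [h]) hz
    have h5 := congrArg (rootCoord φ) hyz
    rw [map_add, h4, add_zero, rootCoord_self] at h5
    rw [h5]
    exact one_ne_zero

/-! ### The trace functional on the nilradical as a sum of roots. -/

lemma mem_nilradical_iff (hq : IsStandardParabolic b q) {x : q} :
    x ∈ nilradical q ↔ (x : L) ∈ positiveLevel b q := by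
  rw [nilradical_eq hq, mem_positiveLevelIdeal]

/-- The nilradical is the span of the root vectors of positive level. -/
def nilradicalEquiv (hq : IsStandardParabolic b q) : positiveLevel b q ≃ₗ[ℂ] nilradical q where
  toFun x := ⟨⟨x, positiveLevel_le hq x.2⟩, (mem_nilradical_iff hq).mpr x.2⟩
  invFun x := ⟨x.1, (mem_nilradical_iff hq).mp x.2⟩
  map_add' _ _ := rfl
  map_smul' _ _ := rfl

/-- The basis of `positiveLevel b q` consisting of root vectors. -/
def positiveLevelBasis (b : (rootSystem H).Base) (q : LieSubalgebra ℂ L) :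
    Basis {φ : H.root // 0 < level b q φ} ℂ (positiveLevel b q) :=
  (Basis.span (linearIndependent_rootVector.comp (Subtype.val : {φ : H.root // 0 < level b q φ} → _)
    Subtype.val_injective)).map (LinearEquiv.ofEq _ _ (by
      rw [positiveLevel, Set.range_comp, Subtype.range_val_subtype]))

lemma positiveLevelBasis_apply (φ : {φ : H.root // 0 < level b q φ}) :
    (positiveLevelBasis b q φ : L) = rootVector φ.1 := by
  rw [positiveLevelBasis, Basis.map_apply, LinearEquiv.coe_ofEq_apply, Basis.span_apply]
  rfl

/-- The basis of the nilradical consisting of root vectors. -/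
def nilradicalBasis (hq : IsStandardParabolic b q) :
    Basis {φ : H.root // 0 < level b q φ} ℂ (nilradical q) :=
  (positiveLevelBasis b q).map (nilradicalEquiv hq)

lemma nilradicalBasis_apply (hq : IsStandardParabolic b q) (φ : {φ : H.root // 0 < level b q φ}) :
    ((nilradicalBasis hq φ : q) : L) = rootVector φ.1 :=
  positiveLevelBasis_apply φ

lemma deltaN_eq_sum (hq : IsStandardParabolic b q) : deltaN q hq.cartan_le =
    ∑ φ : {φ : H.root // 0 < level b q φ}, (rootSystem H).root φ.1 := by
  classical
  ext x
  change LinearMap.trace ℂ (nilradical q) (LieModule.toEnd ℂ q (nilradical q)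
    (LieSubalgebra.inclusion hq.cartan_le x)) = _
  rw [LinearMap.trace_eq_matrix_trace ℂ (nilradicalBasis hq), Matrix.trace, LinearMap.sum_apply]
  refine Finset.sum_congr rfl fun φ _ => ?_
  rw [Matrix.diag_apply, LinearMap.toMatrix_apply]
  have : LieModule.toEnd ℂ q (nilradical q) (LieSubalgebra.inclusion hq.cartan_le x)
      (nilradicalBasis hq φ) = φ.1.1 x • nilradicalBasis hq φ := by
    apply Subtype.ext
    apply Subtype.ext
    change ⁅(x : L), ((nilradicalBasis hq φ : q) : L)⁆ =
      φ.1.1 x • ((nilradicalBasis hq φ : q) : L)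
    rw [nilradicalBasis_apply, lie_rootVector]
  rw [this, map_smul, Basis.repr_self]
  simp

end Parabolic

/-! ### The center and the derived algebra of the Levi factor -/

section Levi

variable {b : (rootSystem H).Base} {q m : LieSubalgebra ℂ L}

open Classical in
/-- The simple roots of the Levi factor of `q`. -/
def innerSimple (b : (rootSystem H).Base) (q : LieSubalgebra ℂ L) : Finset H.root :=
  b.support \ outerSimple b q

lemma mem_innerSimple {α : H.root} :
    α ∈ innerSimple b q ↔ α ∈ b.support ∧ level b q α = 0 := by
  classical
  rw [innerSimple, Finset.mem_sdiff]
  refine and_congr_right fun hα => ⟨level_of_notMem hα, fun h h' => ?_⟩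
  rw [level_of_mem h'] at h
  exact one_ne_zero h

lemma sum_support_eq {M : Type*} [AddCommMonoid M] (f : H.root → M) :
    ∑ α ∈ b.support, f α = ∑ α ∈ outerSimple b q, f α + ∑ α ∈ innerSimple b q, f α := by
  classical
  rw [innerSimple, add_comm, Finset.sum_sdiff outerSimple_subset]

lemma card_support_eq : b.support.card = (outerSimple b q).card + (innerSimple b q).card := by
  simp only [Finset.card_eq_sum_ones]
  exact sum_support_eq _

lemma root_eq_sum_of_level_eq_zero {φ : H.root} (h : level b q φ = 0) :
    (rootSystem H).root φ =
      ∑ α ∈ innerSimple b q, simpleCoeff b α φ • (rootSystem H).root α := by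
  rw [root_eq_sum_simpleCoeff b φ, sum_support_eq (q := q), add_eq_right]
  exact Finset.sum_eq_zero fun α hα => by
    rw [simpleCoeff_eq_zero_of_partialHeight outerSimple_subset h hα, zero_smul]

/-- The complex span of the simple roots of the Levi factor. -/
def innerSpan (b : (rootSystem H).Base) (q : LieSubalgebra ℂ L) : Submodule ℂ (Dual ℂ H) :=
  Submodule.span ℂ ((rootSystem H).root '' innerSimple b q)

lemma innerSpan_eq_span_range : innerSpan b q =
    Submodule.span ℂ (Set.range fun α : innerSimple b q => (rootSystem H).root α.1) := by
  rw [innerSpan, Set.image_eq_range]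
  rfl

lemma leviDerived_le : leviDerived m ≤ m.toSubmodule := by
  rintro _ ⟨x, -, rfl⟩
  exact x.2

lemma lie_mem_leviDerived {x y : L} (hx : x ∈ m) (hy : y ∈ m) : ⁅x, y⁆ ∈ leviDerived m := by
  have hmem (u v : m) : ⁅u, v⁆ ∈ (LieAlgebra.derivedSeries ℂ m 1).toSubmodule :=
    LieSubmodule.lie_mem_lie (I := (⊤ : LieIdeal ℂ m)) (N := (⊤ : LieIdeal ℂ m))
      (LieSubmodule.mem_top _) (LieSubmodule.mem_top _)
  exact Submodule.mem_map_of_mem (f := m.toSubmodule.subtype) (hmem ⟨x, hx⟩ ⟨y, hy⟩)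

lemma mem_leviCenter {x : L} : x ∈ leviCenter m ↔ x ∈ m ∧ ∀ y ∈ m, ⁅x, y⁆ = 0 := by
  constructor
  · rintro ⟨x, hx, rfl⟩
    refine ⟨x.2, fun y hy => ?_⟩
    have h := congrArg Subtype.val ((LieModule.mem_maxTrivSubmodule ℂ m m x).mp hx ⟨y, hy⟩)
    have h' : ⁅y, (x : L)⁆ = 0 := h
    change ⁅(x : L), y⁆ = 0
    rw [← lie_skew, h', neg_zero]
  · rintro ⟨hx, h⟩
    refine ⟨⟨x, hx⟩, (LieModule.mem_maxTrivSubmodule ℂ m m _).mpr fun y => ?_, rfl⟩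
    apply Subtype.ext
    change ⁅(y : L), x⁆ = 0
    rw [← lie_skew, h y y.2, neg_zero]

lemma killingForm_eq_zero_of_mem_leviDerived {x z : L} (hx : x ∈ leviDerived m)
    (hz : z ∈ leviCenter m) : killingForm ℂ L x z = 0 := by
  obtain ⟨x, hx, rfl⟩ := hx
  change x ∈ (⁅(⊤ : LieIdeal ℂ m), (⊤ : LieIdeal ℂ m)⁆ : LieIdeal ℂ m).toSubmodule at hx
  rw [LieSubmodule.lieIdeal_oper_eq_linear_span] at hx
  induction hx using Submodule.span_induction with
  | zero => simp
  | add x y _ _ h h' => rw [map_add, map_add, LinearMap.add_apply, h, h', add_zero]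
  | smul c x _ h => rw [map_smul, map_smul, LinearMap.smul_apply, h, smul_zero]
  | mem x hx =>
    obtain ⟨u, v, rfl⟩ := hx
    change killingForm ℂ L ⁅((u : m) : L), ((v : m) : L)⁆ z = 0
    rw [LieModule.traceForm_apply_lie_apply, ← lie_skew, (mem_leviCenter.mp hz).2 _ v.1.2,
      neg_zero, map_zero]

variable (hq : IsStandardParabolic b q) (hm : IsLeviFactor q m) (hHm : H ≤ m)
include hq hm hHm

/-- Bracketing with the coroot of `φ` doubles the root vector, so a root vector in `m` is a
commutator in `m`. -/
lemma mem_rootsIn_leviDerived_iff {φ : H.root} :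
    φ ∈ rootsIn H (leviDerived m) ↔ level b q φ = 0 := by
  rw [mem_rootsIn_iff, ← rootVector_mem_levi_iff hq hm hHm]
  refine ⟨fun h => leviDerived_le h, fun h => ?_⟩
  have h1 := lie_mem_leviDerived (hHm (coroot φ.1).2) h
  rw [lie_rootVector, root_apply_coroot (H.isNonZero_coe_root φ)] at h1
  exact ((leviDerived m).smul_mem_iff two_ne_zero).mp h1

omit hq hm in
lemma leviCenter_le_cartan : leviCenter m ≤ H.toSubmodule := by
  intro x hx
  refine mem_cartan_of_rootCoord_eq_zero fun φ => ?_
  by_contra h0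
  refine H.isNonZero_coe_root φ ?_
  ext h
  have h1 := rootCoord_lie φ h x
  rw [← lie_skew, (mem_leviCenter.mp hx).2 _ (hHm h.2), neg_zero, map_zero] at h1
  exact (mul_eq_zero.mp h1.symm).resolve_right h0

lemma coe_mem_leviCenter_iff {x : H} :
    (x : L) ∈ leviCenter m ↔ ∀ φ : H.root, level b q φ = 0 → φ.1 x = 0 := by
  constructor
  · intro hx φ hφ
    have h1 := (mem_leviCenter.mp hx).2 _ ((rootVector_mem_levi_iff hq hm hHm).mpr hφ)
    rw [lie_rootVector, smul_eq_zero] at h1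
    exact h1.resolve_right (rootVector_ne_zero φ)
  · intro h
    refine mem_leviCenter.mpr ⟨hHm x.2, fun y hy => ?_⟩
    obtain ⟨z, hz⟩ := exists_eq_add_sum (H := H) y
    rw [hz, lie_add, lie_sum]
    have h1 : ⁅(x : L), (z : L)⁆ = 0 := congrArg Subtype.val (trivial_lie_zero H H x z)
    rw [h1, zero_add]
    refine Finset.sum_eq_zero fun φ _ => ?_
    by_cases h0 : rootCoord φ y = 0
    · rw [h0, zero_smul, lie_zero]
    · have h2 : rootVector φ ∈ m :=
        rootVector_mem_of_rootCoord_ne_zero (lie_mem_of_cartan_le hHm) hy h0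
      rw [lie_smul, lie_rootVector, h φ ((rootVector_mem_levi_iff hq hm hHm).mp h2), zero_smul,
        smul_zero]

lemma coe_mem_leviCenter_iff_innerSimple {x : H} :
    (x : L) ∈ leviCenter m ↔ ∀ α ∈ innerSimple b q, (rootSystem H).root α x = 0 := by
  rw [coe_mem_leviCenter_iff hq hm hHm]
  refine ⟨fun h α hα => h α (mem_innerSimple.mp hα).2, fun h φ hφ => ?_⟩
  rw [← root_apply_eq, root_eq_sum_of_level_eq_zero hφ, LinearMap.sum_apply]
  exact Finset.sum_eq_zero fun α hα => by rw [LinearMap.smul_apply, h α hα, smul_zero]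

/-- The center is the common kernel of the inner simple roots, and a functional vanishing on a
common kernel of finitely many functionals is in their span. -/
lemma mem_innerSpan_of_vanishing {ν : Dual ℂ H}
    (hν : ∀ x : H, (x : L) ∈ leviCenter m → ν x = 0) : ν ∈ innerSpan b q := by
  have h1 : ν ∈ Submodule.span ℂ
      (Set.range fun α : innerSimple b q => (rootSystem H).root α.1) := by
    refine mem_span_of_iInf_ker_le_ker fun x hx => ?_
    refine hν x ((coe_mem_leviCenter_iff_innerSimple hq hm hHm).mpr fun α hα => ?_)
    exact (Submodule.mem_iInf _).mp hx ⟨α, hα⟩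
  rwa [← innerSpan_eq_span_range] at h1

/-- By invariance of the Killing form `s` is orthogonal to `t`, so the functional dual to `h`
vanishes on `t`. Conversely, the bracket of opposite root vectors of `m` is a nonzero multiple of
the dual vector of the root. -/
lemma mem_cartanDerived_iff {h : H} :
    h ∈ cartanDerived H m ↔ cartanEquivDual H h ∈ innerSpan b q := by
  constructor
  · intro hh
    refine mem_innerSpan_of_vanishing hq hm hHm fun x hx => ?_
    rw [cartanEquivDual_apply_apply]
    exact killingForm_eq_zero_of_mem_leviDerived hh hx
  · intro hh
    have h1 : innerSpan b q ≤ (cartanDerived H m).comap (cartanEquivDual H).symm.toLinearMap := by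
      rw [innerSpan, Submodule.span_le]
      rintro _ ⟨α, hα, rfl⟩
      have hα0 := (mem_innerSimple.mp hα).2
      obtain ⟨c, hc, h2⟩ := lie_rootVector_negRoot α
      have h3 := lie_mem_leviDerived ((rootVector_mem_levi_iff hq hm hHm).mpr hα0)
        ((rootVector_mem_levi_iff hq hm hHm (φ := negRoot α)).mpr
          (by rw [level_negRoot, hα0, neg_zero]))
      rw [h2] at h3
      exact ((leviDerived m).smul_mem_iff hc).mp h3
    simpa using h1 hh

omit hq hm hHm in
lemma finrank_innerSpan : finrank ℂ (innerSpan b q) = (innerSimple b q).card := by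
  have h1 : LinearIndependent ℂ (fun α : innerSimple b q => (rootSystem H).root α.1) :=
    b.linearIndepOn_root.mono fun α hα => (mem_innerSimple.mp hα).1
  have h2 := finrank_span_eq_card h1
  rw [Fintype.card_coe] at h2
  rw [← h2, innerSpan_eq_span_range]

lemma finrank_cartanDerived : finrank ℂ (cartanDerived H m) = (innerSimple b q).card := by
  rw [← finrank_innerSpan]
  have : cartanDerived H m = (innerSpan b q).comap (cartanEquivDual H).toLinearMap := by
    ext h
    exact mem_cartanDerived_iff hq hm hHm
  rw [this, Submodule.comap_equiv_eq_map_symm, LinearEquiv.finrank_map_eq]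

/-- The center is the annihilator of the inner span, so its dimension is the rank minus the number
of inner simple roots. -/
lemma finrank_leviCenter : finrank ℂ (leviCenter m) = (outerSimple b q).card := by
  have h1 : leviCenter m = ((innerSpan b q).dualCoannihilator).map H.toSubmodule.subtype := by
    ext x
    constructor
    · intro hx
      refine ⟨⟨x, leviCenter_le_cartan hHm hx⟩, ?_, rfl⟩
      have h2 := (coe_mem_leviCenter_iff_innerSimple hq hm hHm
        (x := ⟨x, leviCenter_le_cartan hHm hx⟩)).mp hx
      refine (Submodule.mem_dualCoannihilator _).mpr fun ν hν => ?_
      induction hν using Submodule.span_induction with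
      | zero => simp
      | add x y _ _ h h' => rw [LinearMap.add_apply, h, h', add_zero]
      | smul c x _ h => rw [LinearMap.smul_apply, h, smul_zero]
      | mem x hx =>
        obtain ⟨α, hα, rfl⟩ := hx
        exact h2 α hα
    · rintro ⟨x, hx, rfl⟩
      refine (coe_mem_leviCenter_iff_innerSimple hq hm hHm).mpr fun α hα => ?_
      exact (Submodule.mem_dualCoannihilator _).mp hx _ (Submodule.subset_span ⟨α, hα, rfl⟩)
  have h3 := Subspace.finrank_add_finrank_dualCoannihilator_eq (innerSpan b q)
  have h4 : finrank ℂ H = b.support.card := by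
    rw [← Subspace.dual_finrank_eq (K := ℂ), finrank_eq_card_basis b.toWeightBasis,
      Fintype.card_coe]
  rw [finrank_innerSpan, h4, card_support_eq (q := q), add_comm] at h3
  rw [h1]
  exact (Submodule.finrank_map_subtype_eq _ _).trans (add_right_cancel h3)

end Levi

/-! ### The real form of the dual of the Cartan subalgebra -/

section Real

lemma pair_eq_apply (μ ν : Dual ℂ H) : pair μ ν = μ ((cartanEquivDual H).symm ν) := by
  rw [pair]
  conv_rhs => rw [← (cartanEquivDual H).apply_symm_apply μ, cartanEquivDual_apply_apply]
  rfl

variable (H) in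
/-- The real part of `pair`, as a real bilinear form. -/
def rePair : Dual ℂ H →ₗ[ℝ] Dual ℂ H →ₗ[ℝ] ℝ :=
  LinearMap.mk₂ ℝ (fun x y => (pair x y).re)
    (fun x y z => by rw [pair_comm _ z, pair_add_right, pair_comm z, pair_comm z, Complex.add_re])
    (fun c x y => by rw [pair_comm _ y, pair_smul_right, pair_comm y]; simp)
    (fun x y z => by simp [pair_add_right])
    (fun c x y => by simp [pair_smul_right])

lemma rePair_apply (μ ν : Dual ℂ H) : rePair H μ ν = (pair μ ν).re := rfl

lemma rePair_comm (μ ν : Dual ℂ H) : rePair H μ ν = rePair H ν μ := by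
  rw [rePair_apply, pair_comm, rePair_apply]

lemma pair_eq_ofReal {μ ν : Dual ℂ H} (hμ : μ ∈ hR H) (hν : ν ∈ hR H) :
    pair μ ν = (rePair H μ ν : ℂ) :=
  Complex.ext (by simp [rePair_apply]) (by simp [pair_im hμ hν])

lemma rePair_self_nonneg {μ : Dual ℂ H} (hμ : μ ∈ hR H) : 0 ≤ rePair H μ μ := by
  rw [rePair_apply, pair_eq_sum, Complex.re_sum]
  refine Finset.sum_nonneg fun χ _ => ?_
  rw [Complex.mul_re, root_apply_im hμ, mul_zero, sub_zero]
  exact mul_self_nonneg _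

lemma eq_zero_of_rePair_self {μ : Dual ℂ H} (hμ : μ ∈ hR H) (h : rePair H μ μ = 0) : μ = 0 :=
  eq_zero_of_pair_self hμ (by rw [pair_eq_ofReal hμ hμ, h, Complex.ofReal_zero])

lemma rePair_self_pos {μ : Dual ℂ H} (hμ : μ ∈ hR H) (h : μ ≠ 0) : 0 < rePair H μ μ :=
  lt_of_le_of_ne (rePair_self_nonneg hμ) fun h0 => h (eq_zero_of_rePair_self hμ h0.symm)

lemma rePair_root_self_pos (α : H.root) :
    0 < rePair H ((rootSystem H).root α) ((rootSystem H).root α) :=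
  rePair_self_pos (root_mem_hR α) ((rootSystem H).ne_zero α)

lemma rePair_root (φ α : H.root) :
    rePair H ((rootSystem H).root φ) ((rootSystem H).root α) =
      (rootSystem H).pairingIn ℤ φ α *
        (rePair H ((rootSystem H).root α) ((rootSystem H).root α) / 2) := by
  have h0 := rePair_root_self_pos α
  have h1 := pair_eq_ofReal (root_mem_hR α) (root_mem_hR α)
  have h2 := pair_eq_ofReal (root_mem_hR φ) (root_mem_hR α)
  have h3 : (((rootSystem H).pairingIn ℤ φ α : ℤ) : ℂ) = φ.1 (coroot α.1) := by
    have := (rootSystem H).algebraMap_pairingIn ℤ φ α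
    rw [rootSystem_pairing_apply] at this
    simpa using this
  rw [pair_eq_apply] at h1 h2
  have h4 : φ.1 (coroot α.1) = 2 * (((rootSystem H).root α) ((cartanEquivDual H).symm
      ((rootSystem H).root α)))⁻¹ * (rootSystem H).root φ ((cartanEquivDual H).symm
      ((rootSystem H).root α)) := by
    change (rootSystem H).root φ (coroot α.1) = _
    rw [coroot, map_nsmul, map_smul, smul_eq_mul, nsmul_eq_mul, Nat.cast_ofNat, mul_assoc]
    rfl
  rw [h4, h1, h2] at h3
  have h5 : (((rootSystem H).pairingIn ℤ φ α : ℤ) : ℝ) =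
      2 * (rePair H ((rootSystem H).root α) ((rootSystem H).root α))⁻¹ *
        rePair H ((rootSystem H).root φ) ((rootSystem H).root α) := by
    exact_mod_cast h3
  rw [h5]
  field_simp

variable {b : (rootSystem H).Base}

lemma rePair_simple_le_zero {α β : H.root} (hα : α ∈ b.support) (hβ : β ∈ b.support)
    (h : α ≠ β) : rePair H ((rootSystem H).root α) ((rootSystem H).root β) ≤ 0 := by
  rw [rePair_root]
  have h1 : ((rootSystem H).pairingIn ℤ α β : ℝ) ≤ 0 := by
    exact_mod_cast b.pairingIn_le_zero_of_ne h hα hβ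
  exact mul_nonpos_of_nonpos_of_nonneg h1 (by have := rePair_root_self_pos β; linarith)

variable (b) in
lemma linearIndepOn_real_root : LinearIndepOn ℝ (rootSystem H).root b.support :=
  b.linearIndepOn_root.restrict_scalars' ℝ

lemma exists_eq_sum_of_mem_span {S : Finset H.root} {x : Dual ℂ H}
    (hx : x ∈ Submodule.span ℝ ((rootSystem H).root '' S)) :
    ∃ c : H.root → ℝ, x = ∑ α ∈ S, c α • (rootSystem H).root α := by
  obtain ⟨c, hc⟩ := (Submodule.mem_span_image_finset_iff_exists_fun' ℝ).mp hx
  exact ⟨c, hc.symm⟩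

lemma hR_eq_span (b : (rootSystem H).Base) :
    hR H = Submodule.span ℝ ((rootSystem H).root '' b.support) := by
  refine le_antisymm ?_ (Submodule.span_mono (Set.image_mono (Set.subset_univ _)))
  rw [hR, realSpan, Submodule.span_le]
  rintro _ ⟨φ, -, rfl⟩
  rw [root_eq_sum_simpleCoeff b φ]
  exact Submodule.sum_mem _ fun α hα => zsmul_mem (S := Submodule ℝ (Dual ℂ H))
    (Submodule.subset_span (Set.mem_image_of_mem _ hα)) _

/-- In a finite set of vectors with pairwise nonpositive products, a combination whose products
with the vectors of the set are nonnegative has nonnegative products with the vectors whose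
products with the set are nonpositive. -/
lemma rePair_sum_nonpos {S : Finset H.root} (hS : S ⊆ b.support) {c : H.root → ℝ}
    (hc : ∀ α ∈ S, 0 ≤ rePair H ((rootSystem H).root α) (∑ β ∈ S, c β • (rootSystem H).root β))
    {α : H.root} (hα : α ∈ b.support) (hαS : α ∉ S) :
    rePair H ((rootSystem H).root α) (∑ β ∈ S, c β • (rootSystem H).root β) ≤ 0 := by
  set r := (rootSystem H).root
  -- Split the combination as `p - n` by the signs of its coefficients. Then `(n, p - n) ≥ 0` and
  -- `(n, p) ≤ 0` give `(n, n) ≤ 0`, hence `n = 0`, and only nonnegative coefficients remain.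
  let p : Dual ℂ H := ∑ β ∈ S, (c β)⁺ • r β
  let n : Dual ℂ H := ∑ β ∈ S, (c β)⁻ • r β
  have hpn : ∑ β ∈ S, c β • r β = p - n := by
    rw [← Finset.sum_sub_distrib]
    exact Finset.sum_congr rfl fun β _ => by rw [← sub_smul, posPart_sub_negPart]
  have h1 : 0 ≤ rePair H n (∑ β ∈ S, c β • r β) := by
    rw [LinearMap.map_sum₂]
    refine Finset.sum_nonneg fun β hβ => ?_
    rw [map_smul, LinearMap.smul_apply, smul_eq_mul]
    exact mul_nonneg (negPart_nonneg _) (hc β hβ)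
  have h2 : rePair H n p ≤ 0 := by
    rw [LinearMap.map_sum₂]
    refine Finset.sum_nonpos fun β hβ => ?_
    rw [map_sum]
    refine Finset.sum_nonpos fun γ hγ => ?_
    rw [map_smul, map_smul, LinearMap.smul_apply, smul_eq_mul, smul_eq_mul, ← mul_assoc]
    by_cases h : β = γ
    · subst h
      have : (c β)⁺ * (c β)⁻ = 0 := by
        rcases le_total 0 (c β) with h | h
        · rw [negPart_eq_zero.mpr h, mul_zero]
        · rw [posPart_eq_zero.mpr h, zero_mul]
      rw [this, zero_mul]
    · exact mul_nonpos_of_nonneg_of_nonpos (mul_nonneg (posPart_nonneg _) (negPart_nonneg _))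
        (rePair_simple_le_zero (hS hβ) (hS hγ) h)
  have hn : n ∈ hR H := Submodule.sum_mem _ fun β _ => Submodule.smul_mem _ _ (root_mem_hR β)
  have h3 : n = 0 := by
    refine eq_zero_of_rePair_self hn (le_antisymm ?_ (rePair_self_nonneg hn))
    rw [hpn, map_sub] at h1
    linarith
  rw [hpn, h3, sub_zero, map_sum]
  refine Finset.sum_nonpos fun β hβ => ?_
  rw [map_smul, smul_eq_mul]
  exact mul_nonpos_of_nonneg_of_nonpos (posPart_nonneg _)
    (rePair_simple_le_zero hα (hS hβ) fun h => hαS (h ▸ hβ))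

/-- A nonzero vector of a real space with a positive definite symmetric form is the first element
of an orthogonal basis. -/
lemma exists_orthogonal_basis_with_first {V : Type*} [AddCommGroup V] [Module ℝ V]
    [FiniteDimensional ℝ V] (B : LinearMap.BilinForm ℝ V) (hB : ∀ x y, B x y = B y x)
    (hpos : ∀ x, x ≠ 0 → 0 < B x x) {v : V} (hv : v ≠ 0) :
    ∃ (k : ℕ) (e : Basis (Fin (k + 1)) ℝ V), (∀ i j, i ≠ j → B (e i) (e j) = 0) ∧ e 0 = v := by
  let W : Submodule ℝ V := LinearMap.ker (B v)
  have hsymm : LinearMap.IsSymm (B.restrict W) := ⟨fun x y => hB x y⟩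
  obtain ⟨w, hw⟩ := LinearMap.BilinForm.exists_orthogonal_basis (B := B.restrict W) hsymm
  refine ⟨_, Basis.mkFinCons v w (fun c x hx h => ?_) (fun z => ?_), ?_, ?_⟩
  · have h1 : B v (c • v + x) = 0 := by rw [h, map_zero]
    rw [map_add, LinearMap.mem_ker.mp hx, add_zero, map_smul, smul_eq_mul] at h1
    exact (mul_eq_zero.mp h1).resolve_right (hpos v hv).ne'
  · refine ⟨-(B v z / B v v), ?_⟩
    rw [LinearMap.mem_ker, map_add, map_smul, smul_eq_mul]
    have := (hpos v hv).ne'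
    field_simp
    ring
  · rw [Basis.coe_mkFinCons]
    intro i j hij
    have hvw : ∀ i, B v (w i) = 0 := fun i => (w i).2
    induction i using Fin.cases with
    | zero =>
      induction j using Fin.cases with
      | zero => exact absurd rfl hij
      | succ j => exact hvw j
    | succ i =>
      induction j using Fin.cases with
      | zero => rw [hB]; exact hvw i
      | succ j => exact hw fun h : i = j => hij (congrArg Fin.succ h)
  · rw [Basis.coe_mkFinCons]
    rfl

end Real

/-! ### Components along the center of the Levi factor -/

section Component

variable {b : (rootSystem H).Base} {q m : LieSubalgebra ℂ L}

lemma tComponent_mem (φ : H.root) : tComponent m φ ∈ tR H m :=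
  (existsUnique_component m (root_mem_hR φ)).choose_spec.1.1

lemma root_sub_tComponent_mem (φ : H.root) :
    (rootSystem H).root φ - tComponent m φ ∈ hsR H m :=
  (existsUnique_component m (root_mem_hR φ)).choose_spec.1.2

lemma tComponent_eq {φ : H.root} {τ : Dual ℂ H} (h1 : τ ∈ tR H m)
    (h2 : (rootSystem H).root φ - τ ∈ hsR H m) : tComponent m φ = τ :=
  ((existsUnique_component m (root_mem_hR φ)).choose_spec.2 τ ⟨h1, h2⟩).symm

lemma eq_zero_of_mem_tR_of_mem_hsR {x : Dual ℂ H} (h1 : x ∈ tR H m) (h2 : x ∈ hsR H m) : x = 0 :=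
  eq_zero_of_pair_self h1.1 (h1.2 x h2)

lemma rePair_eq_zero_of_mem {x y : Dual ℂ H} (hx : x ∈ tR H m) (hy : y ∈ hsR H m) :
    rePair H x y = 0 := by
  rw [rePair_comm, rePair_apply, hx.2 y hy, Complex.zero_re]

lemma rePair_tComponent {x : Dual ℂ H} (hx : x ∈ tR H m) (φ : H.root) :
    rePair H x (tComponent m φ) = rePair H x ((rootSystem H).root φ) := by
  have := rePair_eq_zero_of_mem hx (root_sub_tComponent_mem φ)
  rw [map_sub] at this
  linarith

lemma tComponent_of_eq_add {φ ψ χ : H.root}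
    (h : (rootSystem H).root χ = (rootSystem H).root φ + (rootSystem H).root ψ) :
    tComponent m χ = tComponent m φ + tComponent m ψ := by
  refine tComponent_eq (Submodule.add_mem _ (tComponent_mem φ) (tComponent_mem ψ)) ?_
  rw [h, add_sub_add_comm]
  exact Submodule.add_mem _ (root_sub_tComponent_mem φ) (root_sub_tComponent_mem ψ)

variable (hq : IsStandardParabolic b q) (hm : IsLeviFactor q m) (hHm : H ≤ m)
include hq hm hHm

lemma hsR_eq_span : hsR H m = Submodule.span ℝ ((rootSystem H).root '' innerSimple b q) := by
  apply le_antisymm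
  · rw [hsR, realSpan, Submodule.span_le]
    rintro _ ⟨φ, hφ, rfl⟩
    rw [root_eq_sum_of_level_eq_zero ((mem_rootsIn_leviDerived_iff hq hm hHm).mp hφ)]
    exact Submodule.sum_mem _ fun α hα => zsmul_mem (S := Submodule ℝ (Dual ℂ H))
      (Submodule.subset_span (Set.mem_image_of_mem _ hα)) _
  · exact Submodule.span_mono (Set.image_mono fun α hα =>
      (mem_rootsIn_leviDerived_iff hq hm hHm).mpr (mem_innerSimple.mp hα).2)

lemma root_mem_hsR {φ : H.root} (h : level b q φ = 0) : (rootSystem H).root φ ∈ hsR H m :=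
  Submodule.subset_span ⟨φ, (mem_rootsIn_leviDerived_iff hq hm hHm).mpr h, rfl⟩

lemma tComponent_eq_zero {φ : H.root} (h : level b q φ = 0) : tComponent m φ = 0 :=
  tComponent_eq (Submodule.zero_mem _) (by rw [sub_zero]; exact root_mem_hsR hq hm hHm h)

lemma mem_tR_of_rePair {x : Dual ℂ H} (hx : x ∈ hR H)
    (h : ∀ α ∈ innerSimple b q, rePair H x ((rootSystem H).root α) = 0) : x ∈ tR H m := by
  refine ⟨hx, fun μ hμ => ?_⟩
  rw [pair_eq_ofReal (hsR_le_hR m hμ) hx, rePair_comm]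
  rw [hsR_eq_span hq hm hHm] at hμ
  have : Submodule.span ℝ ((rootSystem H).root '' innerSimple b q) ≤ LinearMap.ker (rePair H x) := by
    rw [Submodule.span_le]
    rintro _ ⟨α, hα, rfl⟩
    exact h α hα
  rw [LinearMap.mem_ker.mp (this hμ), Complex.ofReal_zero]

/-- Modulo `h(s)*_ℝ` inner terms disappear and outer roots become their components. The coefficient
formula, independence and spanning all come from this congruence. -/
lemma sum_sub_sum_tComponent_mem (c : H.root → ℝ) :
    ∑ α ∈ b.support, c α • (rootSystem H).root α - ∑ α ∈ outerSimple b q, c α • tComponent m α ∈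
      hsR H m := by
  rw [sum_support_eq (q := q), add_sub_right_comm, ← Finset.sum_sub_distrib]
  refine Submodule.add_mem _ (Submodule.sum_mem _ fun α _ => ?_) (Submodule.sum_mem _ fun α hα => ?_)
  · rw [← smul_sub]
    exact Submodule.smul_mem _ _ (root_sub_tComponent_mem α)
  · exact Submodule.smul_mem _ _ (root_mem_hsR hq hm hHm (mem_innerSimple.mp hα).2)

lemma tComponent_eq_sum (φ : H.root) :
    tComponent m φ = ∑ α ∈ outerSimple b q, simpleCoeff b α φ • tComponent m α := by
  refine tComponent_eq (Submodule.sum_mem _ fun α _ =>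
    zsmul_mem (S := Submodule ℝ (Dual ℂ H)) (tComponent_mem α) _) ?_
  have := sum_sub_sum_tComponent_mem hq hm hHm (fun α => (simpleCoeff b α φ : ℝ))
  simp_rw [Int.cast_smul_eq_zsmul] at this
  rwa [← root_eq_sum_simpleCoeff] at this

lemma linearIndepOn_tComponent : LinearIndepOn ℝ (tComponent m) (outerSimple b q : Set H.root) := by
  rw [linearIndepOn_finset_iff]
  intro c hc
  classical
  -- Extension by zero: `c'` lives on the outer and `d'` on the inner simple roots, so the relation
  -- can be compared over all simple roots, which are independent.
  let c' : H.root → ℝ := fun α => if α ∈ outerSimple b q then c α else 0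
  have h0 : ∑ α ∈ outerSimple b q, c' α • tComponent m α = 0 := by
    rw [← hc]
    exact Finset.sum_congr rfl fun α hα => by simp only [c', if_pos hα]
  have h1 := sum_sub_sum_tComponent_mem hq hm hHm c'
  rw [h0, sub_zero, hsR_eq_span hq hm hHm] at h1
  obtain ⟨d, hd⟩ := exists_eq_sum_of_mem_span h1
  let d' : H.root → ℝ := fun α => if α ∈ outerSimple b q then 0 else d α
  have h2 : ∑ α ∈ b.support, d' α • (rootSystem H).root α =
      ∑ α ∈ innerSimple b q, d α • (rootSystem H).root α := by
    rw [sum_support_eq (q := q), Finset.sum_eq_zero (fun α hα => by simp only [d', if_pos hα, zero_smul]),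
      zero_add]
    refine Finset.sum_congr rfl fun α hα => ?_
    have : α ∉ outerSimple b q := fun h => by
      have := level_of_mem h
      rw [(mem_innerSimple.mp hα).2] at this
      exact zero_ne_one this
    simp only [d', if_neg this]
  intro α hα
  have h3 : ∑ α ∈ b.support, (c' α - d' α) • (rootSystem H).root α = 0 := by
    simp_rw [sub_smul, Finset.sum_sub_distrib]
    rw [h2, hd, sub_self]
  have h4 := linearIndepOn_finset_iff.mp (linearIndepOn_real_root b) _ h3 α (outerSimple_subset hα)
  simpa [c', d', hα] using h4

lemma span_tComponent :
    Submodule.span ℝ (tComponent m '' outerSimple b q) = tR H m := by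
  apply le_antisymm
  · rw [Submodule.span_le]
    rintro _ ⟨α, -, rfl⟩
    exact tComponent_mem α
  · intro v hv
    have h1 := hv.1
    rw [hR_eq_span b] at h1
    obtain ⟨c, hc⟩ := exists_eq_sum_of_mem_span h1
    have h2 := sum_sub_sum_tComponent_mem hq hm hHm c
    have h3 : v - ∑ α ∈ outerSimple b q, c α • tComponent m α = 0 := by
      refine eq_zero_of_mem_tR_of_mem_hsR (m := m) (Submodule.sub_mem _ hv
        (Submodule.sum_mem _ fun α _ => Submodule.smul_mem _ _ (tComponent_mem α))) ?_
      rwa [← hc] at h2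
    rw [sub_eq_zero.mp h3]
    exact Submodule.sum_mem _ fun α hα => Submodule.smul_mem _ _
      (Submodule.subset_span (Set.mem_image_of_mem _ hα))

/-- The difference `α_t - α` is a combination of inner simple roots whose product with each inner
`γ` is `-(α, γ) ≥ 0`. By `rePair_sum_nonpos` its product with `β` is nonpositive, and so is `(α,
β)`; the sum of the two is `(α_t, β) = (α_t, β_t)`. -/
lemma rePair_tComponent_nonpos {α β : H.root} (hα : α ∈ outerSimple b q)
    (hβ : β ∈ outerSimple b q) (h : α ≠ β) :
    rePair H (tComponent m α) (tComponent m β) ≤ 0 := by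
  have h1 := root_sub_tComponent_mem (m := m) α
  rw [hsR_eq_span hq hm hHm] at h1
  obtain ⟨c, hc⟩ := exists_eq_sum_of_mem_span h1
  have hI : innerSimple b q ⊆ b.support := fun γ hγ => (mem_innerSimple.mp hγ).1
  have hn : ∀ γ ∈ innerSimple b q, ∀ δ ∈ outerSimple b q, γ ≠ δ := by
    rintro γ hγ _ hδ rfl
    have := level_of_mem hδ
    rw [(mem_innerSimple.mp hγ).2] at this
    exact zero_ne_one this
  have h2 : ∑ γ ∈ innerSimple b q, (-c γ) • (rootSystem H).root γ =
      tComponent m α - (rootSystem H).root α := by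
    simp_rw [neg_smul, Finset.sum_neg_distrib]
    rw [← hc, neg_sub]
  have h3 := rePair_sum_nonpos hI (c := fun γ => -c γ) (fun γ hγ => ?_)
    (outerSimple_subset hβ) (fun h' => hn β h' β hβ rfl)
  · rw [rePair_tComponent (tComponent_mem α), rePair_comm]
    rw [h2, map_sub] at h3
    have h4 := rePair_simple_le_zero (outerSimple_subset hβ) (outerSimple_subset hα) h.symm
    linarith
  · rw [h2, map_sub, rePair_comm _ (tComponent m α),
      rePair_eq_zero_of_mem (tComponent_mem α) (root_mem_hsR hq hm hHm (mem_innerSimple.mp hγ).2)]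
    have := rePair_simple_le_zero (hI hγ) (outerSimple_subset hα) (hn γ hγ α hα)
    linarith

/-- The components of the outer simple roots are independent, so the outer coefficients, and with
them the level, can be read off from the component. -/
lemma level_eq_of_tComponent_eq_add {φ ψ χ : H.root}
    (h : tComponent m φ = tComponent m ψ + tComponent m χ) :
    level b q φ = level b q ψ + level b q χ := by
  have h1 : ∑ α ∈ outerSimple b q, ((simpleCoeff b α φ - simpleCoeff b α ψ - simpleCoeff b α χ : ℤ) : ℝ)
      • tComponent m α = 0 := by
    simp_rw [Int.cast_smul_eq_zsmul, sub_smul, Finset.sum_sub_distrib]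
    rw [← tComponent_eq_sum hq hm hHm, ← tComponent_eq_sum hq hm hHm,
      ← tComponent_eq_sum hq hm hHm, h]
    abel
  rw [level, level, level, partialHeight, partialHeight, partialHeight, ← Finset.sum_add_distrib]
  refine Finset.sum_congr rfl fun α hα => ?_
  have h2 := linearIndepOn_finset_iff.mp (linearIndepOn_tComponent hq hm hHm) _ h1 α hα
  have h3 : simpleCoeff b α φ - simpleCoeff b α ψ - simpleCoeff b α χ = 0 := by exact_mod_cast h2
  lia

lemma tComponent_ne_zero {φ : H.root} (h : level b q φ ≠ 0) : tComponent m φ ≠ 0 := by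
  intro h0
  have := level_eq_of_tComponent_eq_add hq hm hHm (φ := φ) (ψ := φ) (χ := φ) (by rw [h0, add_zero])
  lia

/-- The component of a root of positive level is that of an outer simple root, or a sum of two
components of roots of positive level. -/
lemma tComponent_eq_simple_or_add {φ : H.root} (h : 0 < level b q φ) :
    (∃ α ∈ outerSimple b q, tComponent m φ = tComponent m α) ∨
      ∃ ψ χ, 0 < level b q ψ ∧ 0 < level b q χ ∧
        tComponent m φ = tComponent m ψ + tComponent m χ := by
  have hp : b.IsPos φ := isPos_of_partialHeight_pos outerSimple_subset h
  suffices b.IsPos φ ∧ (0 < level b q φ → (∃ α ∈ outerSimple b q, tComponent m φ = tComponent m α) ∨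
      ∃ ψ χ, 0 < level b q ψ ∧ 0 < level b q χ ∧
        tComponent m φ = tComponent m ψ + tComponent m χ) from this.2 h
  clear h
  refine hp.induction_on_add (p := fun φ => b.IsPos φ ∧ (0 < level b q φ →
    (∃ α ∈ outerSimple b q, tComponent m φ = tComponent m α) ∨
      ∃ ψ χ, 0 < level b q ψ ∧ 0 < level b q χ ∧
        tComponent m φ = tComponent m ψ + tComponent m χ)) (fun α hα => ?_) fun φ α χ hχ hφ hα => ?_
  · refine ⟨b.isPos_of_mem_support hα, fun h => Or.inl ⟨α, ?_, rfl⟩⟩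
    by_contra hn
    rw [level_of_notMem hα hn] at h
    exact lt_irrefl _ h
  · refine ⟨hφ.1.add (b.isPos_of_mem_support hα) hχ, fun h => ?_⟩
    have h1 : level b q χ = level b q φ + level b q α :=
      partialHeight_of_eq_add outerSimple_subset hχ
    have h2 : 0 ≤ level b q φ := partialHeight_nonneg hφ.1
    have h3 := tComponent_of_eq_add (m := m) hχ
    -- Adding an inner root leaves the component unchanged. Adding an outer one gives `α_t` itself
    -- when `φ` has level `0`, and otherwise a genuine decomposition.
    by_cases hα' : α ∈ outerSimple b q
    · rcases h2.eq_or_lt with h4 | h4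
      · refine Or.inl ⟨α, hα', ?_⟩
        rw [h3, tComponent_eq_zero hq hm hHm h4.symm, zero_add]
      · exact Or.inr ⟨φ, α, h4, by rw [level_of_mem hα']; exact one_pos, h3⟩
    · have h4 := level_of_notMem hα hα'
      rw [h4, add_zero] at h1
      rw [tComponent_eq_zero hq hm hHm h4, add_zero] at h3
      rw [h3]
      exact hφ.2 (h1 ▸ h)

end Component

/-! ### The functional `deltaN` -/

section Delta

variable {b : (rootSystem H).Base} {q m : LieSubalgebra ℂ L}

lemma level_reflectionPerm (α φ : H.root) :
    level b q ((rootSystem H).reflectionPerm α φ) =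
      level b q φ - (rootSystem H).pairingIn ℤ φ α * level b q α := by
  have h : (rootSystem H).root ((rootSystem H).reflectionPerm α φ) =
      (rootSystem H).root φ + (-(rootSystem H).pairingIn ℤ φ α) • (rootSystem H).root α := by
    rw [RootPairing.root_reflectionPerm, RootPairing.reflection_apply_root' ℤ, neg_smul,
      sub_eq_add_neg]
  rw [level, partialHeight_of_eq_add_zsmul outerSimple_subset h, level, level]
  ring

lemma pairingIn_reflectionPerm (α φ : H.root) :
    (rootSystem H).pairingIn ℤ ((rootSystem H).reflectionPerm α φ) α =
      -(rootSystem H).pairingIn ℤ φ α := by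
  have h : ((((rootSystem H).pairingIn ℤ ((rootSystem H).reflectionPerm α φ) α : ℤ) : ℂ)) =
      ((-(rootSystem H).pairingIn ℤ φ α : ℤ) : ℂ) := by
    have h1 := (rootSystem H).algebraMap_pairingIn ℤ ((rootSystem H).reflectionPerm α φ) α
    have h2 := (rootSystem H).algebraMap_pairingIn ℤ φ α
    rw [← RootPairing.pairing_reflectionPerm, RootPairing.pairing_reflectionPerm_self_right,
      ← h2] at h1
    simpa using h1
  exact_mod_cast h

open Classical in
-- Reflection in `α` negates the pairing, and for a root with negative pairing it does not lower the
-- level. So it matches each negative term of the sum with a positive one that cancels it, and `T`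
-- is the set of unmatched positive terms. When `α` has positive level it stays unmatched: its
-- partner would be `-α`, of negative level.
lemma sum_pairingIn_eq {α : H.root} (hα : 0 ≤ level b q α) :
    ∃ T : Finset H.root, (∀ φ ∈ T, 0 < (rootSystem H).pairingIn ℤ φ α) ∧
      (0 < level b q α → α ∈ T) ∧
      ∑ φ ∈ Finset.univ.filter (fun φ : H.root => 0 < level b q φ), (rootSystem H).pairingIn ℤ φ α =
        ∑ φ ∈ T, (rootSystem H).pairingIn ℤ φ α := by
  set p : H.root → ℤ := fun φ => (rootSystem H).pairingIn ℤ φ α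
  let s : H.root ↪ H.root := ((rootSystem H).reflectionPerm α).toEmbedding
  have hps : ∀ φ, p (s φ) = -p φ := fun φ => pairingIn_reflectionPerm α φ
  have hls : ∀ φ, level b q (s φ) = level b q φ - p φ * level b q α :=
    fun φ => level_reflectionPerm α φ
  let S : Finset H.root := Finset.univ.filter fun φ : H.root => 0 < level b q φ
  let P := S.filter fun φ => 0 < p φ
  let N := S.filter fun φ => p φ < 0
  have hNP : N.map s ⊆ P := by
    intro φ hφ
    obtain ⟨ψ, hψ, rfl⟩ := Finset.mem_map.mp hφ
    obtain ⟨h1, h2⟩ := Finset.mem_filter.mp hψ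
    refine Finset.mem_filter.mpr ⟨Finset.mem_filter.mpr ⟨Finset.mem_univ _, ?_⟩, ?_⟩
    · rw [hls]
      have := (Finset.mem_filter.mp h1).2
      nlinarith
    · rw [hps]; lia
  refine ⟨P \ N.map s, fun φ hφ => ?_, fun h => ?_, ?_⟩
  · exact (Finset.mem_filter.mp (Finset.mem_sdiff.mp hφ).1).2
  · have hp : p α = 2 := RootPairing.pairingIn_same _ _ _
    refine Finset.mem_sdiff.mpr ⟨Finset.mem_filter.mpr
      ⟨Finset.mem_filter.mpr ⟨Finset.mem_univ _, h⟩, by rw [hp]; exact two_pos⟩, fun h' => ?_⟩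
    obtain ⟨ψ, hψ, h1⟩ := Finset.mem_map.mp h'
    have h2 := hls ψ
    have h3 := hps ψ
    rw [h1] at h2 h3
    have h4 := (Finset.mem_filter.mp (Finset.mem_filter.mp hψ).1).2
    have h5 : p ψ = -2 := by lia
    rw [h5] at h2
    lia
  · have h1 : ∑ φ ∈ S, p φ = ∑ φ ∈ P, p φ + ∑ φ ∈ N, p φ := by
      simp only [P, N, Finset.sum_filter, ← Finset.sum_add_distrib]
      refine Finset.sum_congr rfl fun φ _ => ?_
      rcases lt_trichotomy (p φ) 0 with h | h | h
      · rw [if_neg (by lia), if_pos h, zero_add]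
      · rw [h]; simp
      · rw [if_pos h, if_neg (by lia), add_zero]
    have h2 := Finset.sum_sdiff (f := p) hNP
    rw [Finset.sum_map, Finset.sum_congr rfl fun φ _ => hps φ, Finset.sum_neg_distrib] at h2
    change ∑ φ ∈ S, p φ = _
    rw [h1, ← h2]
    ring

lemma deltaN_mem_hR (hq : IsStandardParabolic b q) : deltaN q hq.cartan_le ∈ hR H := by
  rw [deltaN_eq_sum hq]
  exact Submodule.sum_mem _ fun φ _ => root_mem_hR φ.1

open Classical in
lemma rePair_deltaN (hq : IsStandardParabolic b q) (α : H.root) :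
    rePair H (deltaN q hq.cartan_le) ((rootSystem H).root α) =
      (∑ φ ∈ Finset.univ.filter (fun φ : H.root => 0 < level b q φ),
        (rootSystem H).pairingIn ℤ φ α : ℤ) *
        (rePair H ((rootSystem H).root α) ((rootSystem H).root α) / 2) := by
  rw [deltaN_eq_sum hq, LinearMap.map_sum₂, Int.cast_sum, Finset.sum_mul,
    Finset.sum_subtype (p := fun φ => 0 < level b q φ) _ (fun φ => by simp)]
  exact Finset.sum_congr rfl fun φ _ => rePair_root φ.1 α

lemma rePair_deltaN_nonneg (hq : IsStandardParabolic b q) {α : H.root} (hα : 0 ≤ level b q α) :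
    0 ≤ rePair H (deltaN q hq.cartan_le) ((rootSystem H).root α) := by
  classical
  obtain ⟨T, h1, -, h2⟩ := sum_pairingIn_eq hα
  rw [rePair_deltaN hq, h2]
  have := rePair_root_self_pos α
  exact mul_nonneg (by exact_mod_cast Finset.sum_nonneg fun φ hφ => (h1 φ hφ).le) (by linarith)

lemma rePair_deltaN_pos (hq : IsStandardParabolic b q) {α : H.root} (hα : 0 < level b q α) :
    0 < rePair H (deltaN q hq.cartan_le) ((rootSystem H).root α) := by
  classical
  obtain ⟨T, h1, h2, h3⟩ := sum_pairingIn_eq hα.le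
  rw [rePair_deltaN hq, h3]
  have := rePair_root_self_pos α
  exact mul_pos (by exact_mod_cast Finset.sum_pos h1 ⟨α, h2 hα⟩) (by linarith)

/-- At level `0` the inequality `rePair_deltaN_nonneg` applies to both `α` and `-α`. -/
lemma rePair_deltaN_eq_zero (hq : IsStandardParabolic b q) {α : H.root} (hα : level b q α = 0) :
    rePair H (deltaN q hq.cartan_le) ((rootSystem H).root α) = 0 := by
  have h1 := rePair_deltaN_nonneg hq hα.ge
  have h2 := rePair_deltaN_nonneg hq (α := negRoot α) (by rw [level_negRoot, hα, neg_zero])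
  rw [root_negRoot, map_neg] at h2
  linarith

lemma rePair_deltaN_neg (hq : IsStandardParabolic b q) {α : H.root} (hα : level b q α < 0) :
    rePair H (deltaN q hq.cartan_le) ((rootSystem H).root α) < 0 := by
  have h2 := rePair_deltaN_pos hq (α := negRoot α) (by rw [level_negRoot]; lia)
  rw [root_negRoot, map_neg] at h2
  linarith

lemma exists_level_pos (hq : IsStandardParabolic b q) (hq_ne : q ≠ ⊤) :
    ∃ α : H.root, 0 < level b q α := by
  by_contra! hn
  refine hq_ne (eq_top_iff.mpr fun x _ => ?_)
  obtain ⟨h, hh⟩ := exists_eq_add_sum (H := H) x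
  rw [hh]
  refine q.add_mem (hq.cartan_le h.2) (q.toSubmodule.sum_mem fun φ _ => q.smul_mem _ ?_)
  rw [rootVector_mem_parabolic_iff hq]
  have := hn (negRoot φ)
  rw [level_negRoot] at this
  lia

variable (hq : IsStandardParabolic b q) (hm : IsLeviFactor q m) (hHm : H ≤ m)

include hm hHm in
lemma deltaN_mem_tR : deltaN q hq.cartan_le ∈ tR H m :=
  mem_tR_of_rePair hq hm hHm (deltaN_mem_hR hq) fun _ hα =>
    rePair_deltaN_eq_zero hq (mem_innerSimple.mp hα).2

lemma deltaN_ne_zero (hq_ne : q ≠ ⊤) : deltaN q hq.cartan_le ≠ 0 := by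
  intro h0
  obtain ⟨α, hα⟩ := exists_level_pos hq hq_ne
  have := rePair_deltaN_pos hq hα
  rw [h0, map_zero, LinearMap.zero_apply] at this
  exact lt_irrefl _ this

include hm hHm in
lemma exists_isAdmissible (hq_ne : q ≠ ⊤) :
    ∃ (k : ℕ) (e : Basis (Fin (k + 1)) ℝ (tR H m)), IsAdmissible hq.cartan_le e := by
  have hfin : FiniteDimensional ℝ (hR H) := FiniteDimensional.span_of_finite ℝ (Set.toFinite _)
  have hfin' : FiniteDimensional ℝ (tR H m) :=
    Submodule.finiteDimensional_of_le (S₂ := hR H) fun _ h => h.1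
  let B : LinearMap.BilinForm ℝ (tR H m) :=
    (rePair H).compl₁₂ (tR H m).subtype (tR H m).subtype
  obtain ⟨k, e, he, he0⟩ := exists_orthogonal_basis_with_first B (fun x y => rePair_comm _ _)
    (fun x hx => rePair_self_pos x.2.1 (by simpa using hx))
    (v := ⟨_, deltaN_mem_tR hq hm hHm⟩) (by simpa [Subtype.ext_iff] using deltaN_ne_zero hq hq_ne)
  refine ⟨k, e, fun i j hij => ?_, by rw [he0]⟩
  have h1 : rePair H (e i : Dual ℂ H) (e j) = 0 := he i j hij
  rw [pair_eq_ofReal (e i).2.1 (e j).2.1, h1, Complex.ofReal_zero]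

end Delta

/-! ### Positive and simple `t`-roots -/

section TRoots

variable {b : (rootSystem H).Base} {q m : LieSubalgebra ℂ L}

lemma mem_rootsIn_tWeightSpace_iff {φ : H.root} {ν : Dual ℂ H} :
    φ ∈ rootsIn H (tWeightSpace m ν) ↔
      ∀ x : H, (x : L) ∈ leviCenter m → (rootSystem H).root φ x = ν x := by
  rw [mem_rootsIn_iff]
  refine forall₂_congr fun x _ => ?_
  rw [lie_rootVector, ← sub_eq_zero, ← sub_smul, smul_eq_zero_iff_left (rootVector_ne_zero φ),
    sub_eq_zero]
  rfl

variable (hq : IsStandardParabolic b q) (hm : IsLeviFactor q m) (hHm : H ≤ m)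
include hq hm hHm

/-- Orthogonality to the real span passes to the complex span by linearity; this is the bridge from
`t*_ℝ` to the complex dual of `t`. -/
lemma pair_eq_zero_of_mem_innerSpan {μ ν : Dual ℂ H} (hμ : μ ∈ innerSpan b q) (hν : ν ∈ tR H m) :
    pair ν μ = 0 := by
  rw [pair_comm, pair_eq_apply]
  induction hμ using Submodule.span_induction with
  | zero => rfl
  | add x y _ _ h h' => rw [LinearMap.add_apply, h, h', add_zero]
  | smul c x _ h => rw [LinearMap.smul_apply, h, smul_zero]
  | mem x hx =>
    obtain ⟨α, hα, rfl⟩ := hx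
    rw [← pair_eq_apply]
    exact hν.2 _ (root_mem_hsR hq hm hHm (mem_innerSimple.mp hα).2)

lemma eq_zero_of_mem_tR_of_vanishing {ν : Dual ℂ H} (hν : ν ∈ tR H m)
    (h : ∀ x : H, (x : L) ∈ leviCenter m → ν x = 0) : ν = 0 :=
  eq_zero_of_pair_self hν.1
    (pair_eq_zero_of_mem_innerSpan hq hm hHm (mem_innerSpan_of_vanishing hq hm hHm h) hν)

lemma mem_tDual_of_mem_tR {ν : Dual ℂ H} (hν : ν ∈ tR H m) : ν ∈ tDual H m := by
  refine (Submodule.mem_dualAnnihilator _).mpr fun h hh => ?_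
  have := pair_eq_zero_of_mem_innerSpan hq hm hHm ((mem_cartanDerived_iff hq hm hHm).mp hh) hν
  rwa [pair_eq_apply, LinearEquiv.symm_apply_apply] at this

lemma root_apply_eq_tComponent_apply (φ : H.root) {x : H} (hx : (x : L) ∈ leviCenter m) :
    (rootSystem H).root φ x = tComponent m φ x := by
  have h1 := root_sub_tComponent_mem (m := m) φ
  rw [hsR_eq_span hq hm hHm] at h1
  obtain ⟨c, hc⟩ := exists_eq_sum_of_mem_span h1
  have h2 := LinearMap.congr_fun hc x
  rw [LinearMap.sub_apply, LinearMap.sum_apply, Finset.sum_eq_zero fun α hα => ?_] at h2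
  · exact sub_eq_zero.mp h2
  · rw [LinearMap.smul_apply, (coe_mem_leviCenter_iff_innerSimple hq hm hHm).mp hx α hα, smul_zero]

lemma mem_rootsIn_tWeightSpace_iff_tComponent_eq {φ : H.root} {ν : Dual ℂ H} (hν : ν ∈ tR H m) :
    φ ∈ rootsIn H (tWeightSpace m ν) ↔ tComponent m φ = ν := by
  rw [mem_rootsIn_tWeightSpace_iff]
  constructor
  · intro h
    refine sub_eq_zero.mp (eq_zero_of_mem_tR_of_vanishing hq hm hHm
      (Submodule.sub_mem _ (tComponent_mem φ) hν) fun x hx => ?_)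
    rw [LinearMap.sub_apply, ← root_apply_eq_tComponent_apply hq hm hHm φ hx, h x hx, sub_self]
  · rintro rfl x hx
    exact root_apply_eq_tComponent_apply hq hm hHm φ hx

/-- A nonzero weight vector without root coordinates would lie in the Cartan subalgebra, where `t`
acts by zero, forcing `ν = 0`. -/
lemma rootsIn_tWeightSpace_nonempty {ν : Dual ℂ H} (hν : ν ∈ tR H m) (h0 : ν ≠ 0)
    (h : tWeightSpace m ν ≠ ⊥) : (rootsIn H (tWeightSpace m ν)).Nonempty := by
  obtain ⟨z, hz, hz0⟩ := (Submodule.ne_bot_iff _).mp h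
  have hstable : ∀ h : H, ∀ z ∈ tWeightSpace m ν, ⁅(h : L), z⁆ ∈ tWeightSpace m ν := by
    intro h z hz x hx
    have h1 : ⁅(x : L), (h : L)⁆ = 0 := congrArg Subtype.val (trivial_lie_zero H H x h)
    rw [leibniz_lie, h1, zero_lie, zero_add, hz x hx, lie_smul]
  by_contra hn
  have h1 : ∀ φ : H.root, rootCoord φ z = 0 := by
    intro φ
    by_contra h2
    exact hn ⟨φ, mem_rootsIn_iff.mpr (rootVector_mem_of_rootCoord_ne_zero hstable hz h2)⟩
  have h2 := mem_cartan_of_rootCoord_eq_zero h1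
  refine h0 (eq_zero_of_mem_tR_of_vanishing hq hm hHm hν fun x hx => ?_)
  have h3 := hz x hx
  have h4 : ⁅(x : L), z⁆ = 0 := congrArg Subtype.val (trivial_lie_zero H H x ⟨z, h2⟩)
  rw [h4, eq_comm, smul_eq_zero] at h3
  exact h3.resolve_right hz0

variable {k : ℕ} {e : Basis (Fin (k + 1)) ℝ (tR H m)} (he : IsAdmissible hq.cartan_le e)
include he

omit hm hHm in
-- Thus the first lexicographic coordinate has the sign of the product with `δ_n`.
lemma rePair_deltaN_eq_repr (v : tR H m) : rePair H (deltaN q hq.cartan_le) v =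
    e.repr v 0 * rePair H (deltaN q hq.cartan_le) (deltaN q hq.cartan_le) := by
  have h1 : (v : Dual ℂ H) = ∑ i, e.repr v i • (e i : Dual ℂ H) := by
    have h := congrArg (tR H m).subtype (e.sum_repr v)
    rw [map_sum] at h
    exact h.symm
  conv_lhs => rw [h1]
  rw [map_sum, Finset.sum_eq_single_of_mem 0 (Finset.mem_univ _) fun i _ hi => ?_, map_smul,
    he.first, smul_eq_mul]
  rw [map_smul, ← he.first, rePair_apply, he.orthogonal _ _ hi.symm, Complex.zero_re, smul_zero]

/-- A `t`-root in `t*_ℝ` is some `φ_t`, with `φ` of nonzero level because `φ_t ≠ 0`. Its first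
coordinate has the sign of that level, so the later basis vectors never matter. -/
lemma mem_posRoots_iff (hq_ne : q ≠ ⊤) {ν : Dual ℂ H} :
    ν ∈ posRoots e ↔ ∃ φ : H.root, 0 < level b q φ ∧ tComponent m φ = ν := by
  have hδ := rePair_self_pos (deltaN_mem_hR hq) (deltaN_ne_zero hq hq_ne)
  have key : ∀ (φ : H.root) (v : tR H m), tComponent m φ = v →
      rePair H (deltaN q hq.cartan_le) ((rootSystem H).root φ) =
        e.repr v 0 * rePair H (deltaN q hq.cartan_le) (deltaN q hq.cartan_le) := by
    intro φ v h
    rw [← rePair_deltaN_eq_repr hq he, ← h, rePair_tComponent (deltaN_mem_tR hq hm hHm)]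
  constructor
  · rintro ⟨⟨-, h0, h1⟩, v, rfl, i, hi, hi'⟩
    obtain ⟨φ, hφ⟩ := rootsIn_tWeightSpace_nonempty hq hm hHm v.2 h0 h1
    rw [mem_rootsIn_tWeightSpace_iff_tComponent_eq hq hm hHm v.2] at hφ
    refine ⟨φ, ?_, hφ⟩
    have h2 := key φ v hφ
    rcases lt_trichotomy (level b q φ) 0 with h3 | h3 | h3
    · have h4 := rePair_deltaN_neg hq h3
      rw [h2] at h4
      by_cases hi0 : i = 0
      · subst hi0
        exact absurd h4 (not_lt.mpr (mul_pos hi' hδ).le)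
      -- A first nonzero coordinate at `i ≠ 0` would make the product with `δ_n` vanish.
      · rw [hi 0 (Fin.pos_iff_ne_zero.mpr hi0), zero_mul] at h4
        exact absurd h4 (lt_irrefl _)
    · exact absurd (hφ.symm.trans (tComponent_eq_zero hq hm hHm h3)) h0
    · exact h3
  · rintro ⟨φ, hφ, rfl⟩
    refine ⟨⟨mem_tDual_of_mem_tR hq hm hHm (tComponent_mem φ),
      tComponent_ne_zero hq hm hHm hφ.ne', fun h => ?_⟩, ⟨_, tComponent_mem φ⟩, rfl, 0,
      fun j hj => absurd hj (Fin.not_lt_zero j), ?_⟩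
    · have h1 := (mem_rootsIn_tWeightSpace_iff_tComponent_eq hq hm hHm
        (tComponent_mem φ)).mpr rfl
      rw [mem_rootsIn_iff, h, Submodule.mem_bot] at h1
      exact rootVector_ne_zero φ h1
    · have h1 := rePair_deltaN_pos hq hφ
      rw [key φ ⟨_, tComponent_mem φ⟩ rfl] at h1
      exact pos_of_mul_pos_left h1 hδ.le

lemma simpleRoots_posRoots (hq_ne : q ≠ ⊤) :
    simpleRoots (posRoots e) = tComponent m '' outerSimple b q := by
  ext ν
  constructor
  · rintro ⟨h1, h2⟩
    obtain ⟨φ, hφ, rfl⟩ := (mem_posRoots_iff hq hm hHm he hq_ne).mp h1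
    rcases tComponent_eq_simple_or_add hq hm hHm hφ with ⟨α, hα, h3⟩ | ⟨ψ, χ, hψ, hχ, h3⟩
    · exact ⟨α, hα, h3.symm⟩
    · exact absurd ⟨_, (mem_posRoots_iff hq hm hHm he hq_ne).mpr ⟨ψ, hψ, rfl⟩, _,
        (mem_posRoots_iff hq hm hHm he hq_ne).mpr ⟨χ, hχ, rfl⟩, h3⟩ h2
  · rintro ⟨α, hα, rfl⟩
    have h1 := level_of_mem hα
    refine ⟨(mem_posRoots_iff hq hm hHm he hq_ne).mpr ⟨α, by rw [h1]; exact one_pos, rfl⟩, ?_⟩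
    rintro ⟨_, hν₁, _, hν₂, h⟩
    obtain ⟨φ, hφ, rfl⟩ := (mem_posRoots_iff hq hm hHm he hq_ne).mp hν₁
    obtain ⟨ψ, hψ, rfl⟩ := (mem_posRoots_iff hq hm hHm he hq_ne).mp hν₂
    have := level_eq_of_tComponent_eq_add hq hm hHm h
    lia

end TRoots

/-! ### Enumerations of the simple roots -/

section Ordering

variable {b : (rootSystem H).Base} {q m : LieSubalgebra ℂ L}
  (hq : IsStandardParabolic b q) (hm : IsLeviFactor q m) (hHm : H ≤ m)
include hq hm hHm

lemma nonempty_simpleOrdering : Nonempty (SimpleOrdering b m) := by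
  classical
  let f : Fin (finrank ℂ (leviCenter m)) ≃ outerSimple b q :=
    (finCongr (finrank_leviCenter hq hm hHm)).trans (outerSimple b q).equivFin.symm
  let g : Fin (finrank ℂ (cartanDerived H m)) ≃ innerSimple b q :=
    (finCongr (finrank_cartanDerived hq hm hHm)).trans (innerSimple b q).equivFin.symm
  let t : (outerSimple b q : Type _) ⊕ (innerSimple b q : Type _) → b.support :=
    Sum.elim (fun α => ⟨α.1, outerSimple_subset α.2⟩) fun α => ⟨α.1, (mem_innerSimple.mp α.2).1⟩
  have ht : Function.Bijective t := by
    rw [Fintype.bijective_iff_surjective_and_card]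
    refine ⟨fun α => ?_, by simp [card_support_eq (q := q)]⟩
    by_cases h : α.1 ∈ outerSimple b q
    · exact ⟨.inl ⟨α.1, h⟩, rfl⟩
    · exact ⟨.inr ⟨α.1, mem_innerSimple.mpr ⟨α.2, level_of_notMem α.2 h⟩⟩, rfl⟩
  exact ⟨⟨(Equiv.sumCongr f g).trans (Equiv.ofBijective t ht), fun i =>
    (mem_rootsIn_leviDerived_iff hq hm hHm).mpr (mem_innerSimple.mp (g i).2).2⟩⟩

variable (α : SimpleOrdering b m)

omit hq hm hHm in
lemma SimpleOrdering.root_injective : Function.Injective α.root := fun _ _ h =>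
  Sum.inl_injective (α.toEquiv.injective (Subtype.ext h))

/-- The last `ℓ(s)` entries are distinct inner simple roots, and there are exactly `ℓ(s)` of those;
the first `ℓ(t)` entries must then be all the outer ones. -/
lemma SimpleOrdering.range_root : Set.range α.root = outerSimple b q := by
  have h1 : ∀ i, (α.toEquiv (.inr i) : H.root) ∈ innerSimple b q := fun i =>
    mem_innerSimple.mpr ⟨(α.toEquiv (.inr i)).2,
      (mem_rootsIn_leviDerived_iff hq hm hHm).mp (α.mem_derived i)⟩
  let f : Fin (finrank ℂ (cartanDerived H m)) → innerSimple b q := fun i => ⟨_, h1 i⟩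
  have hf : Function.Bijective f := by
    rw [Fintype.bijective_iff_injective_and_card]
    refine ⟨fun i j h => ?_, ?_⟩
    · have h' : (α.toEquiv (.inr i) : H.root) = α.toEquiv (.inr j) :=
        congrArg (fun x : innerSimple b q => x.1) h
      exact Sum.inr_injective (α.toEquiv.injective (Subtype.ext h'))
    · rw [Fintype.card_fin, Fintype.card_coe, finrank_cartanDerived hq hm hHm]
  ext φ
  constructor
  · rintro ⟨j, rfl⟩
    by_contra hn
    have h2 : α.root j ∈ b.support := (α.toEquiv (.inl j)).2
    obtain ⟨i, hi⟩ := hf.2 ⟨α.root j, mem_innerSimple.mpr ⟨h2, level_of_notMem h2 hn⟩⟩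
    have h3 : (α.toEquiv (.inr i) : H.root) = α.toEquiv (.inl j) :=
      congrArg (fun x : innerSimple b q => x.1) hi
    exact Sum.inr_ne_inl (α.toEquiv.injective (Subtype.ext h3))
  · intro hφ
    obtain ⟨x, hx⟩ := α.toEquiv.surjective ⟨φ, outerSimple_subset hφ⟩
    have hx' : (α.toEquiv x : H.root) = φ := congrArg Subtype.val hx
    rcases x with j | i
    · exact ⟨j, hx'⟩
    · have h2 := (mem_innerSimple.mp (h1 i)).2
      rw [hx', level_of_mem hφ] at h2
      exact absurd h2 one_ne_zero

lemma SimpleOrdering.root_mem (j : Fin (finrank ℂ (leviCenter m))) :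
    α.root j ∈ outerSimple b q := by
  have h : α.root j ∈ (outerSimple b q : Set H.root) := by
    rw [← α.range_root hq hm hHm]
    exact ⟨j, rfl⟩
  exact h

lemma SimpleOrdering.sum_root {M : Type*} [AddCommMonoid M] (f : H.root → M) :
    ∑ j, f (α.root j) = ∑ φ ∈ outerSimple b q, f φ := by
  refine Finset.sum_bij (fun j _ => α.root j) (fun j _ => α.root_mem hq hm hHm j)
    (fun i _ j _ h => α.root_injective h) (fun φ hφ => ?_) fun _ _ => rfl
  have h : φ ∈ Set.range α.root := by
    rw [α.range_root hq hm hHm]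
    exact hφ
  obtain ⟨j, hj⟩ := h
  exact ⟨j, Finset.mem_univ _, hj⟩

lemma SimpleOrdering.range_beta : Set.range α.beta = tComponent m '' outerSimple b q := by
  rw [← α.range_root hq hm hHm, ← Set.range_comp]
  rfl

lemma SimpleOrdering.linearIndependent_beta : LinearIndependent ℝ α.beta :=
  (linearIndepOn_tComponent hq hm hHm).comp
    (fun j => (⟨α.root j, α.root_mem hq hm hHm j⟩ : (outerSimple b q : Set H.root)))
    fun _ _ h => α.root_injective (congrArg (fun x : (outerSimple b q : Set H.root) => x.1) h)

end Ordering

end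

end LeviRoots

/-! ### The theorem. -/

theorem theorem2p7 {L : Type*} [LieRing L] [LieAlgebra ℂ L] [FiniteDimensional ℂ L]
    [LieAlgebra.IsSemisimple ℂ L] (H : LieSubalgebra ℂ L) [H.IsCartanSubalgebra]
    (b : (LieAlgebra.IsKilling.rootSystem H).Base)
    (q m : LieSubalgebra ℂ L) (hq : LeviRoots.IsStandardParabolic b q) (hq_ne : q ≠ ⊤)
    (hm : LeviRoots.IsLeviFactor q m) (hHm : H ≤ m) :
    Nonempty (LeviRoots.SimpleOrdering b m) ∧
    (∃ (k : ℕ) (e : Module.Basis (Fin (k + 1)) ℝ (LeviRoots.tR H m)),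
      LeviRoots.IsAdmissible hq.cartan_le e) ∧
    ∀ (α : LeviRoots.SimpleOrdering b m)
      (k : ℕ) (e : Module.Basis (Fin (k + 1)) ℝ (LeviRoots.tR H m)),
      LeviRoots.IsAdmissible hq.cartan_le e →
      LeviRoots.simpleRoots (LeviRoots.posRoots e) = Set.range α.beta ∧
      LinearIndependent ℝ α.beta ∧
      Submodule.span ℝ (Set.range α.beta) = LeviRoots.tR H m ∧
      (∀ i j, i ≠ j →
        (LeviRoots.pair (α.beta i) (α.beta j)).im = 0 ∧
        (LeviRoots.pair (α.beta i) (α.beta j)).re ≤ 0) ∧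
      ∀ ν ∈ LeviRoots.posRoots e,
        (LeviRoots.rootsIn H (LeviRoots.tWeightSpace m ν)).Nonempty ∧
        ∀ φ ∈ LeviRoots.rootsIn H (LeviRoots.tWeightSpace m ν),
          ν = ∑ j, LeviRoots.simpleCoeff b (α.root j) φ • α.beta j := by
  classical
  refine ⟨LeviRoots.nonempty_simpleOrdering hq hm hHm,
    LeviRoots.exists_isAdmissible hq hm hHm hq_ne, fun α k e he =>
    ⟨?_, α.linearIndependent_beta hq hm hHm, ?_, fun i j hij => ⟨?_, ?_⟩, fun ν hν => ?_⟩⟩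
  · rw [LeviRoots.simpleRoots_posRoots hq hm hHm he hq_ne, α.range_beta hq hm hHm]
  · rw [α.range_beta hq hm hHm, LeviRoots.span_tComponent hq hm hHm]
  · exact LeviRoots.pair_im (LeviRoots.tComponent_mem _).1 (LeviRoots.tComponent_mem _).1
  · exact LeviRoots.rePair_tComponent_nonpos hq hm hHm (α.root_mem hq hm hHm i)
      (α.root_mem hq hm hHm j) (α.root_injective.ne hij)
  · obtain ⟨φ₀, -, rfl⟩ := (LeviRoots.mem_posRoots_iff hq hm hHm he hq_ne).mp hν
    have key : ∀ φ : H.root, φ ∈ LeviRoots.rootsIn H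
        (LeviRoots.tWeightSpace m (LeviRoots.tComponent m φ₀)) ↔
          LeviRoots.tComponent m φ = LeviRoots.tComponent m φ₀ := fun φ =>
      LeviRoots.mem_rootsIn_tWeightSpace_iff_tComponent_eq hq hm hHm (LeviRoots.tComponent_mem φ₀)
    refine ⟨⟨φ₀, (key φ₀).mpr rfl⟩, fun φ hφ => ?_⟩
    rw [← (key φ).mp hφ, LeviRoots.tComponent_eq_sum hq hm hHm φ]
    exact (α.sum_root hq hm hHm
      fun x => LeviRoots.simpleCoeff b x φ • LeviRoots.tComponent m x).symm
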